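/- Let $\mathcal S$ be the group of permutations of the set $\{0,1,2,\dots\}$ of nonnegative integers with finite support. Let $\mathbf C[\mathcal S]$ be its group algebra, with the involution $(\sum_\sigma x_\sigma\sigma)^*=\sum_\sigma\overline{x_\sigma}\,\sigma^{-1}$ and the canonical trace $\varphi(\sum_\sigma x_\sigma\sigma)=x_{\mathrm{id}}$. Fix $p\ge 1$, integers $r_1,\dots,r_p\ge 0$ and real numbers $0\le t_0<t_1<\dots<t_p$. For $i=1,\dots,p$ and $n\ge 1$, put $$M_i(n)=n^{-r_i/2}\sum (0\,a_1\,a_2\cdots a_{r_i})\in\mathbf C[\mathcal S],$$ where the sum runs over all $r_i$-tuples $(a_1,\dots,a_{r_i})$ of pairwise distinct integers of $(nt_{i-1},nt_i]$, and $(0\,a_1\cdots a_r)$ is the cycle $0\to a_1\to\dots\to a_r\to 0$ (so that $M_i(n)=\mathrm{id}$ if $r_i=0$). Then $M_1(n),\dots,M_p(n)$ are asymptotically free as $n\to\infty$. That is, they are self-adjoint, and there are a noncommutative probability space $(\mathcal A,\psi)$ (a complex unital $*$-algebra with a linear form satisfying $\psi(1)=1$, $\psi(x^*)=\overline{\psi(x)}$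 and $\psi(xx^*)\ge 0$ for all $x\in\mathcal A$) and self-adjoint elements $m_1,\dots,m_p\in\mathcal A$, free with respect to $\psi$, such that for every noncommutative polynomial $P\in\mathbf C\langle X_1,\dots,X_p\rangle$ $$\lim_{n\to\infty}\varphi\bigl(P(M_1(n),\dots,M_p(n))\bigr)=\psi\bigl(P(m_1,\dots,m_p)\bigr).$$ Here free means: whenever $k\ge 1$, $i_1\ne i_2$, $i_2\ne i_3$, …, $i_{k-1}\ne i_k$, and each $x_j$ belongs to the unital algebra generated by $m_{i_j}$ and satisfies $\psi(x_j)=0$, one has $\psi(x_1\cdots x_k)=0$. -/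

import Mathlib

open Filter Topology
open scoped ComplexOrder

/-! ### Noncommutative probability -/

/-- A state on a complex unital `*`-algebra `A`: a linear form `φ` with `φ 1 = 1`,
`φ (x*) = conj (φ x)` and `φ (x x*) ≥ 0`. The pair `(A, φ)` is a noncommutative probability
space. -/
structure NCState (A : Type*) [Ring A] [StarRing A] [Algebra ℂ A] [StarModule ℂ A]
    extends A →ₗ[ℂ] ℂ where
  map_one' : toFun 1 = 1
  map_star' : ∀ x, toFun (star x) = star (toFun x)
  nonneg' : ∀ x, 0 ≤ toFun (x * star x)

/-- The elements `x i` are free with respect to the linear form `φ`: a nonempty product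
`a₁ ⋯ a_k` of centered elements, with `a_j` in the unital algebra generated by `x (i_j)` and
with neighbouring indices `i_j ≠ i_{j+1}`, is centered. -/
def IsFreeFamily {ι A : Type*} [Ring A] [Algebra ℂ A] (φ : A →ₗ[ℂ] ℂ) (x : ι → A) : Prop :=
  ∀ l : List (ι × A), l ≠ [] → (l.map Prod.fst).IsChain (· ≠ ·) →
    (∀ q ∈ l, q.2 ∈ Algebra.adjoin ℂ {x q.1} ∧ φ q.2 = 0) →
    φ (l.map Prod.snd).prod = 0

/-- The noncommutative distribution of the family `x`, as the function which maps a
noncommutative polynomial `P` to `φ (P (x))`. -/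
noncomputable def ncDistribution {ι A : Type*} [Ring A] [Algebra ℂ A] (φ : A →ₗ[ℂ] ℂ)
    (x : ι → A) (P : FreeAlgebra ℂ ι) : ℂ :=
  φ (FreeAlgebra.lift ℂ x P)

/-- A sequence `x n = (x n i)_i` of families of self-adjoint elements of a noncommutative
probability space `(B, φ)` is asymptotically free as `n → ∞`: its noncommutative distribution
converges pointwise to that of a free family of self-adjoint elements of some noncommutative
probability space. -/
def AsymptoticallyFree {ι B : Type*} [Ring B] [StarRing B] [Algebra ℂ B] [StarModule ℂ B]
    (φ : NCState B) (x : ℕ → ι → B) : Prop :=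
  (∀ n i, IsSelfAdjoint (x n i)) ∧
  ∃ (A : Type) (_ : Ring A) (_ : StarRing A) (_ : Algebra ℂ A) (_ : StarModule ℂ A)
    (ψ : NCState A) (s : ι → A),
    (∀ i, IsSelfAdjoint (s i)) ∧ IsFreeFamily ψ.toLinearMap s ∧
    ∀ P : FreeAlgebra ℂ ι,
      Tendsto (fun n => ncDistribution φ.toLinearMap (x n) P) atTop
        (𝓝 (ncDistribution ψ.toLinearMap s P))

/-! ### The `*`-algebra of a group and its canonical trace -/

section GroupAlgebra

variable {G : Type*} [Group G]

/-- The conjugate-linear map `∑ x_g g ↦ ∑ conj (x_g) g⁻¹`. -/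
noncomputable instance groupAlgebraStar : Star (MonoidAlgebra ℂ G) where
  star x := x.coeff.sum fun g c => MonoidAlgebra.single g⁻¹ (star c)

theorem groupAlgebra_star_single (g : G) (c : ℂ) :
    star (MonoidAlgebra.single g c) = MonoidAlgebra.single g⁻¹ (star c) := by
  change Finsupp.sum _ _ = _
  simp

theorem groupAlgebra_star_add (x y : MonoidAlgebra ℂ G) : star (x + y) = star x + star y := by
  change Finsupp.sum _ _ = Finsupp.sum _ _ + Finsupp.sum _ _
  rw [MonoidAlgebra.coeff_add]
  exact Finsupp.sum_add_index' (by simp) (by simp)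

noncomputable instance groupAlgebraStarRing : StarRing (MonoidAlgebra ℂ G) where
  star_involutive x := by
    induction x using MonoidAlgebra.induction_linear with
    | zero => change Finsupp.sum (Finsupp.sum _ _ : MonoidAlgebra ℂ G).coeff _ = _; simp
    | add x y hx hy => rw [groupAlgebra_star_add, groupAlgebra_star_add, hx, hy]
    | single g c => simp [groupAlgebra_star_single]
  star_mul x y := by
    have h0 : star (0 : MonoidAlgebra ℂ G) = 0 := by change Finsupp.sum _ _ = _; simp
    induction x using MonoidAlgebra.induction_linear with
    | zero => simp [h0]
    | add x x' hx hx' => rw [add_mul, groupAlgebra_star_add, groupAlgebra_star_add, hx, hx', mul_add]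
    | single g c =>
      induction y using MonoidAlgebra.induction_linear with
      | zero => simp [h0]
      | add y y' hy hy' =>
        rw [mul_add, groupAlgebra_star_add, groupAlgebra_star_add, hy, hy', add_mul]
      | single h d =>
        simp [groupAlgebra_star_single, MonoidAlgebra.single_mul_single, mul_comm]
  star_add := groupAlgebra_star_add

instance groupAlgebraStarModule : StarModule ℂ (MonoidAlgebra ℂ G) where
  star_smul a x := by
    induction x using MonoidAlgebra.induction_linear with
    | zero => simp
    | add x y hx hy => rw [smul_add, star_add, star_add, hx, hy, smul_add]
    | single g c => simp [groupAlgebra_star_single, MonoidAlgebra.smul_single]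

/-- The linear form `∑ x_g g ↦ x_1`. -/
noncomputable def groupTraceLinear (G : Type*) [Group G] : MonoidAlgebra ℂ G →ₗ[ℂ] ℂ where
  toFun x := x.coeff 1
  map_add' x y := by simp
  map_smul' a x := by simp

theorem groupAlgebra_star_coeff (x : MonoidAlgebra ℂ G) (g : G) :
    (star x).coeff g = star (x.coeff g⁻¹) := by
  classical
  induction x using MonoidAlgebra.induction_linear with
  | zero => simp
  | add x y hx hy => simp [star_add, hx, hy]
  | single h c =>
    rw [groupAlgebra_star_single, MonoidAlgebra.coeff_single, MonoidAlgebra.coeff_single,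
      Finsupp.single_apply, Finsupp.single_apply]
    by_cases hg : h⁻¹ = g
    · subst hg; simp
    · have : h ≠ g⁻¹ := fun e => hg (by simp [e])
      simp [hg, this]

theorem groupTrace_mul_star (x : MonoidAlgebra ℂ G) :
    (x * star x).coeff 1 = x.coeff.sum fun _ c => c * star c := by
  classical
  have key : ∀ y : MonoidAlgebra ℂ G,
      (x * y).coeff 1 = x.coeff.sum fun g c => c * y.coeff g⁻¹ := by
    intro y
    induction x using MonoidAlgebra.induction_linear with
    | zero => simp
    | add x x' hx hx' =>
      rw [add_mul, MonoidAlgebra.coeff_add, MonoidAlgebra.coeff_add, Finsupp.add_apply, hx, hx',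
        Finsupp.sum_add_index' (by simp) (by intros; ring)]
    | single g c => simp
  rw [key]
  exact Finsupp.sum_congr fun g _ => by rw [groupAlgebra_star_coeff, inv_inv]

/-- The canonical trace `∑ x_g g ↦ x_1` on the group algebra `ℂ[G]`, as a state. -/
noncomputable def groupTrace (G : Type*) [Group G] : NCState (MonoidAlgebra ℂ G) where
  toLinearMap := groupTraceLinear G
  map_one' := by
    change (1 : MonoidAlgebra ℂ G).coeff 1 = 1
    simp [MonoidAlgebra.one_def]
  map_star' x := by
    change (star x).coeff 1 = star (x.coeff 1)
    simp [groupAlgebra_star_coeff]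
  nonneg' x := by
    change 0 ≤ (x * star x).coeff 1
    rw [groupTrace_mul_star]
    exact Finset.sum_nonneg fun g _ => mul_star_self_nonneg _

end GroupAlgebra

/-! ### The permutation model -/

/-- The group of permutations of the set of nonnegative integers with finite support. -/
def finPerm : Subgroup (Equiv.Perm ℕ) where
  carrier := {σ | {k | σ k ≠ k}.Finite}
  one_mem' := by simp
  mul_mem' {σ τ} hσ hτ := (Set.Finite.union hσ hτ).subset fun k hk => by
    by_contra h
    simp only [Set.mem_union, Set.mem_ofPred_eq, not_or, not_not] at h
    exact hk (by rw [Equiv.Perm.mul_apply, h.2, h.1])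
  inv_mem' {σ} hσ := Set.Finite.subset hσ fun k hk h =>
    hk (by rw [Equiv.Perm.inv_eq_iff_eq]; exact h.symm)

/-- The cycle `(0 a₁ ⋯ a_r)`, that is `0 → a₁ → ⋯ → a_r → 0`, for a tuple `a` of pairwise
distinct positive integers. For `r = 0` it is the identity. -/
def zeroCycle {r : ℕ} (a : Fin r → ℕ) : finPerm :=
  ⟨List.formPerm (0 :: List.ofFn a),
    (Finset.finite_toSet _).subset (List.support_formPerm_le' (0 :: List.ofFn a))⟩

open Classical in
/-- The finite set of all `r`-tuples of pairwise distinct nonnegative integers of the interval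
`(u, v]`. -/
noncomputable def distinctTuples (r : ℕ) (u v : ℝ) : Finset (Fin r → ℕ) :=
  (Fintype.piFinset fun _ : Fin r =>
    (Finset.range (⌊v⌋₊ + 1)).filter fun k : ℕ => u < (k : ℝ) ∧ (k : ℝ) ≤ v).filter
    Function.Injective

theorem mem_distinctTuples (r : ℕ) (u v : ℝ) (a : Fin r → ℕ) :
    a ∈ distinctTuples r u v ↔
      (∀ j, u < (a j : ℝ) ∧ (a j : ℝ) ≤ v) ∧ Function.Injective a := by
  simp only [distinctTuples, Finset.mem_filter, Fintype.mem_piFinset, Finset.mem_range]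
  refine and_congr_left fun _ => forall_congr' fun j => and_iff_right_of_imp fun h => ?_
  exact Nat.lt_succ_of_le (Nat.le_floor h.2)

/-- The element `n^{-r/2} ∑ (0 a₁ ⋯ a_r)` of `ℂ[𝒮]`, where `𝒮` is the group of finitely supported
permutations of the nonnegative integers and the sum runs over all `r`-tuples of pairwise distinct
integers of `(n u, n v]`. -/
noncomputable def cycleSum (r : ℕ) (u v : ℝ) (n : ℕ) : MonoidAlgebra ℂ finPerm :=
  (((n : ℝ) ^ (-(r : ℝ) / 2) : ℝ) : ℂ) •
    ∑ a ∈ distinctTuples r (n * u) (n * v), MonoidAlgebra.of ℂ finPerm (zeroCycle a)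

/-! The cycle of a tuple is a product of transpositions `(0 a)`, so each `M_i(n)` is a normalized
sum of products `(0 a₁) ⋯ (0 a_r)` over lists without repetitions with letters in the `i`-th
interval. More generally, every word `w` in the indices gives such a sum `cycleSeq w`, where the
`j`-th letter runs through the interval of index `w_j`; then `M_i(n)` belongs to the word `i ⋯ i`.

Multiplying on the left by the one-letter sum `[i]` gives three kinds of terms. A new letter
produces the word `i :: w`. A letter equal to the head cancels it, which contributes the length of
the interval times the tail of `w`, and requires `i` to be the head of `w`. A letter repeated from
the tail produces too few terms to survive the normalization in `ℓ²`-norm. Up to sequences null in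
`ℓ²`, this is the multiplication rule of free semicircular elements, the words `i ⋯ i` playing the
role of Chebyshev polynomials (`singleton_mul_cycleSeq`, `singleton_mul_cycleSeq_cons`).

Computing modulo null sequences requires that they form an ideal of the algebra generated by the
`cycleSeq w`. By Cauchy–Schwarz (`l2sq_mul_sq_le`) it suffices that elements of this algebra are
bounded in `ℓ²`. Positivity of coefficients reduces this to moments of `∑ (0 b)`, which are bounded
because in a product equal to the identity each letter occurs at least twice.

Modulo the ideal, an element of the algebra generated by `M_i` is a combination of words in the
single letter `i`, and being centered means that the empty word is absent. In an alternating product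
such words just concatenate (`cycleSeq_mul_sub_mem_nullIdeal`), so only nonempty words occur, and
these have trace zero (`coeff_one_wordSum`). The limit of the traces is therefore a state for which
the sequences `M_i` are free. -/

section L2

/-! ### The `ℓ²`-norm on the group algebra and positivity of coefficients -/

variable {G : Type*}

/-- The squared `ℓ²`-norm `∑ |x_g|²` of an element of the group algebra. -/
noncomputable def l2sq (x : MonoidAlgebra ℂ G) : ℝ := x.coeff.sum fun _ c => ‖c‖ ^ 2

theorem l2sq_eq_sum {x : MonoidAlgebra ℂ G} {F : Finset G} (h : x.coeff.support ⊆ F) :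
    l2sq x = ∑ g ∈ F, ‖x.coeff g‖ ^ 2 :=
  Finsupp.sum_of_support_subset _ h _ (by simp)

theorem l2sq_nonneg (x : MonoidAlgebra ℂ G) : 0 ≤ l2sq x :=
  Finset.sum_nonneg fun _ _ => by positivity

theorem sum_le_l2sq (x : MonoidAlgebra ℂ G) (F : Finset G) :
    ∑ g ∈ F, ‖x.coeff g‖ ^ 2 ≤ l2sq x := by
  classical
  rw [l2sq_eq_sum (F := F ∪ x.coeff.support) Finset.subset_union_right]
  exact Finset.sum_le_sum_of_subset_of_nonneg Finset.subset_union_left fun _ _ _ => by positivity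

variable [Group G]

theorem coe_l2sq (x : MonoidAlgebra ℂ G) : ((l2sq x : ℝ) : ℂ) = (x * star x).coeff 1 := by
  rw [groupTrace_mul_star, l2sq, Finsupp.sum, Finsupp.sum]
  push_cast
  refine Finset.sum_congr rfl fun g _ => ?_
  rw [← Complex.mul_conj']
  rfl

theorem coeff_one_mul_comm (x y : MonoidAlgebra ℂ G) : (x * y).coeff 1 = (y * x).coeff 1 := by
  classical
  induction x using MonoidAlgebra.induction_linear with
  | zero => simp
  | add x x' hx hx' => simp [add_mul, mul_add, hx, hx']
  | single g c =>
    induction y using MonoidAlgebra.induction_linear with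
    | zero => simp
    | add y y' hy hy' =>
      simp only [add_mul, mul_add, MonoidAlgebra.coeff_add, Finsupp.add_apply, hy, hy']
    | single h d =>
      simp only [MonoidAlgebra.single_mul_single, MonoidAlgebra.coeff_single, Finsupp.single_apply,
        mul_comm c d, mul_eq_one_iff_eq_inv, eq_comm (a := h), inv_eq_iff_eq_inv]

theorem l2sq_star (x : MonoidAlgebra ℂ G) : l2sq (star x) = l2sq x := by
  have h : ((l2sq (star x) : ℝ) : ℂ) = l2sq x := by
    rw [coe_l2sq, coe_l2sq, star_star, coeff_one_mul_comm]
  exact_mod_cast h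

theorem coeff_one_mul_star (x y : MonoidAlgebra ℂ G) :
    (x * star y).coeff 1 = x.coeff.sum fun g c => c * star (y.coeff g) := by
  classical
  induction x using MonoidAlgebra.induction_linear with
  | zero => simp
  | add x x' hx hx' =>
    rw [add_mul, MonoidAlgebra.coeff_add, MonoidAlgebra.coeff_add, Finsupp.add_apply, hx, hx',
      Finsupp.sum_add_index' (by simp) (by intros; ring)]
  | single g c => simp [groupAlgebra_star_coeff]

theorem norm_coeff_one_mul_star_sq_le (x y : MonoidAlgebra ℂ G) :
    ‖(x * star y).coeff 1‖ ^ 2 ≤ l2sq x * l2sq y := by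
  rw [coeff_one_mul_star, Finsupp.sum]
  calc _ ≤ (∑ g ∈ x.coeff.support, ‖x.coeff g‖ * ‖y.coeff g‖) ^ 2 := by
        refine pow_le_pow_left₀ (norm_nonneg _) ((norm_sum_le _ _).trans (le_of_eq ?_)) 2
        exact Finset.sum_congr rfl fun g _ => by rw [norm_mul, norm_star]
    _ ≤ _ := Finset.sum_mul_sq_le_sq_mul_sq _ _ _
    _ ≤ _ := mul_le_mul_of_nonneg_left (sum_le_l2sq y _) (l2sq_nonneg x)

theorem norm_coeff_one_sq_le (x : MonoidAlgebra ℂ G) : ‖x.coeff 1‖ ^ 2 ≤ l2sq x := by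
  simpa using sum_le_l2sq x {1}

/-- Cauchy–Schwarz applied to `τ(b* b x x*)`. It replaces an operator norm bound on `b`: smallness
of `x` passes to `b * x` as soon as `b* b x` is bounded in `ℓ²`. -/
theorem l2sq_mul_sq_le (b x : MonoidAlgebra ℂ G) :
    l2sq (b * x) ^ 2 ≤ l2sq (star b * (b * x)) * l2sq x := by
  have h : ((l2sq (b * x) : ℝ) : ℂ) = (star b * (b * x) * star x).coeff 1 := by
    rw [coe_l2sq, star_mul, mul_assoc (star b), coeff_one_mul_comm (star b), ← mul_assoc]
  have := norm_coeff_one_mul_star_sq_le (star b * (b * x)) x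
  rwa [← h, Complex.norm_real, Real.norm_eq_abs, sq_abs] at this

theorem l2sq_smul (c : ℂ) (x : MonoidAlgebra ℂ G) : l2sq (c • x) = ‖c‖ ^ 2 * l2sq x := by
  rw [l2sq_eq_sum (x := c • x) (F := x.coeff.support), l2sq, Finsupp.sum, Finset.mul_sum]
  · exact Finset.sum_congr rfl fun g _ => by simp [mul_pow]
  · rw [MonoidAlgebra.coeff_smul]; exact Finsupp.support_smul

theorem l2sq_add_le (x y : MonoidAlgebra ℂ G) : l2sq (x + y) ≤ 2 * l2sq x + 2 * l2sq y := by
  classical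
  rw [l2sq_eq_sum (x := x + y) (F := x.coeff.support ∪ y.coeff.support)]
  · rw [l2sq_eq_sum (x := x) Finset.subset_union_left,
      l2sq_eq_sum (x := y) Finset.subset_union_right, Finset.mul_sum, Finset.mul_sum,
      ← Finset.sum_add_distrib]
    refine Finset.sum_le_sum fun g _ => ?_
    have h1 := norm_add_le (x.coeff g) (y.coeff g)
    rw [MonoidAlgebra.coeff_add, Finsupp.add_apply]
    nlinarith [norm_nonneg (x.coeff g + y.coeff g), sq_nonneg (‖x.coeff g‖ - ‖y.coeff g‖)]
  · rw [MonoidAlgebra.coeff_add]; exact Finsupp.support_add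

theorem coeff_sum_smul_of {α : Type*} [DecidableEq G] (S : Finset α) (c : α → ℂ) (g : α → G)
    (h : G) : (∑ a ∈ S, c a • MonoidAlgebra.of ℂ G (g a)).coeff h = ∑ a ∈ S with g a = h, c a := by
  rw [MonoidAlgebra.coeff_sum, Finsupp.finsetSum_apply, Finset.sum_filter]
  exact Finset.sum_congr rfl fun a _ => by simp [Finsupp.single_apply]

/-- Cauchy–Schwarz on each fibre of `g`. Estimating a sum of permutations thus reduces to counting
its terms and their coincidences. -/
theorem l2sq_sum_le {α : Type*} [DecidableEq G] (S : Finset α) (c : α → ℂ) (g : α → G) (K : ℕ)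
    (hK : ∀ h, (S.filter fun a => g a = h).card ≤ K) :
    l2sq (∑ a ∈ S, c a • MonoidAlgebra.of ℂ G (g a)) ≤ K * ∑ a ∈ S, ‖c a‖ ^ 2 := by
  rw [l2sq_eq_sum (F := S.image g)]
  · have hS := Finset.sum_fiberwise_of_maps_to (t := S.image g)
      (fun a ha => Finset.mem_image_of_mem g ha) (fun a => ‖c a‖ ^ 2)
    rw [← hS, Finset.mul_sum]
    refine Finset.sum_le_sum fun h _ => ?_
    rw [coeff_sum_smul_of]
    calc _ ≤ (∑ a ∈ S with g a = h, ‖c a‖) ^ 2 :=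
          pow_le_pow_left₀ (norm_nonneg _) (norm_sum_le _ _) 2
      _ ≤ _ := sq_sum_le_card_mul_sum_sq
      _ ≤ _ := by gcongr; exact hK h
  · intro h hh
    rw [Finsupp.mem_support_iff, coeff_sum_smul_of] at hh
    obtain ⟨a, ha, _⟩ := Finset.exists_ne_zero_of_sum_ne_zero hh
    rw [Finset.mem_filter] at ha
    exact Finset.mem_image.2 ⟨a, ha.1, ha.2⟩

/-- The elements of the group algebra with nonnegative coefficients. -/
def nonnegCoeff (G : Type*) [Group G] : Subsemiring (MonoidAlgebra ℂ G) where
  carrier := {x | ∀ g, 0 ≤ x.coeff g}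
  zero_mem' := by simp
  one_mem' g := by
    classical
    rw [MonoidAlgebra.one_def, MonoidAlgebra.coeff_single, Finsupp.single_apply]
    split_ifs <;> simp
  add_mem' {x y} hx hy g := by
    rw [MonoidAlgebra.coeff_add, Finsupp.add_apply]; exact add_nonneg (hx g) (hy g)
  mul_mem' {x y} hx hy g := by
    classical
    rw [MonoidAlgebra.coeff_mul]
    refine Finset.sum_nonneg fun a _ => Finset.sum_nonneg fun b _ => ?_
    dsimp only
    split_ifs
    · exact mul_nonneg (hx a) (hy b)
    · exact le_rfl

theorem of_mem_nonnegCoeff (g : G) : MonoidAlgebra.of ℂ G g ∈ nonnegCoeff G := fun h => by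
  classical
  rw [MonoidAlgebra.of_apply, MonoidAlgebra.coeff_single, Finsupp.single_apply]
  split_ifs <;> simp

theorem smul_mem_nonnegCoeff {c : ℝ} (hc : 0 ≤ c) {x : MonoidAlgebra ℂ G} (hx : x ∈ nonnegCoeff G) :
    (c : ℂ) • x ∈ nonnegCoeff G := fun g => by
  rw [MonoidAlgebra.coeff_smul, Finsupp.smul_apply]
  exact mul_nonneg (by exact_mod_cast hc) (hx g)

theorem mul_sub_mul_mem_nonnegCoeff {x y x' y' : MonoidAlgebra ℂ G} (hx : x ∈ nonnegCoeff G)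
    (hy : y - x ∈ nonnegCoeff G) (hx' : x' ∈ nonnegCoeff G) (hy' : y' - x' ∈ nonnegCoeff G) :
    y * y' - x * x' ∈ nonnegCoeff G := by
  have h : y * y' - x * x' = (y - x) * (y' - x') + (y - x) * x' + x * (y' - x') := by noncomm_ring
  rw [h]
  exact add_mem (add_mem (mul_mem hy hy') (mul_mem hy hx')) (mul_mem hx hy')

end L2

/-! ### Products of transpositions `(0 a)` and the letters they move -/

section Cycles

/-- The transposition `(0 a)`. -/
def zeroSwap (a : ℕ) : finPerm :=
  ⟨Equiv.swap 0 a, (Set.toFinite {0, a}).subset fun k hk => by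
    by_contra h
    simp only [Set.mem_insert_iff, Set.mem_singleton_iff, not_or] at h
    exact hk (Equiv.swap_apply_of_ne_of_ne h.1 h.2)⟩

/-- The product of transpositions `(0 a₁) (0 a₂) ⋯ (0 a_m)`. -/
def swapProd (l : List ℕ) : finPerm := (l.map zeroSwap).prod

@[simp] theorem swapProd_nil : swapProd [] = 1 := rfl

@[simp] theorem swapProd_cons (a : ℕ) (l : List ℕ) :
    swapProd (a :: l) = zeroSwap a * swapProd l := by simp [swapProd]

theorem zeroSwap_mul_self (a : ℕ) : zeroSwap a * zeroSwap a = 1 :=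
  Subtype.ext (Equiv.swap_mul_self 0 a)

theorem swapProd_append (l l' : List ℕ) : swapProd (l ++ l') = swapProd l * swapProd l' := by
  simp [swapProd]

theorem inv_swapProd (l : List ℕ) : (swapProd l)⁻¹ = swapProd l.reverse := by
  induction l with
  | nil => simp
  | cons a l ih =>
    rw [swapProd_cons, mul_inv_rev, ih, List.reverse_cons, swapProd_append]
    simpa using inv_eq_of_mul_eq_one_right (zeroSwap_mul_self a)

theorem coe_swapProd (l : List ℕ) :
    (swapProd l : Equiv.Perm ℕ) = (l.map (Equiv.swap 0)).prod := by
  induction l with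
  | nil => rfl
  | cons a l ih => simp [← ih]; rfl

/-- The factor `(x a)` moves through the product one transposition at a time, by `(x a)(a b) = (x
b)(x a)`. -/
theorem swap_mul_prod_map_swap {α : Type*} [DecidableEq α] {x a : α} (l : List α)
    (h : ∀ b ∈ l, b ≠ x ∧ b ≠ a) :
    Equiv.swap x a * (l.map (Equiv.swap a)).prod = (l.map (Equiv.swap x)).prod * Equiv.swap x a := by
  induction l with
  | nil => simp
  | cons b l ih =>
    rw [List.forall_mem_cons] at h
    have hb : Equiv.swap x a * Equiv.swap a b = Equiv.swap x b * Equiv.swap x a := by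
      have := Equiv.swap_mul_swap_mul_swap (x := b) (y := a) (z := x) h.1.2 h.1.1
      rw [Equiv.swap_comm a b, Equiv.swap_comm x b, Equiv.swap_comm b x, ← this, Equiv.swap_comm x a]
      simp [mul_assoc]
    rw [List.map_cons, List.prod_cons, List.map_cons, List.prod_cons, ← mul_assoc, hb, mul_assoc,
      ih h.2, mul_assoc]

theorem formPerm_cons_eq_prod {α : Type*} [DecidableEq α] (x : α) (l : List α)
    (h : (x :: l).Nodup) : (x :: l).formPerm = (l.reverse.map (Equiv.swap x)).prod := by
  induction l generalizing x with
  | nil => simp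
  | cons a l ih =>
    rw [List.formPerm_cons_cons, ih a h.of_cons, swap_mul_prod_map_swap]
    · simp
    · intro b hb
      simp only [List.nodup_cons, List.mem_cons, not_or] at h
      rw [List.mem_reverse] at hb
      exact ⟨fun e => h.1.2 (e ▸ hb), fun e => h.2.1 (e ▸ hb)⟩

theorem zeroCycle_eq_swapProd {r : ℕ} (a : Fin r → ℕ) (ha : Function.Injective a)
    (h0 : ∀ j, a j ≠ 0) : zeroCycle a = swapProd (List.ofFn a).reverse := by
  apply Subtype.ext
  rw [coe_swapProd, ← formPerm_cons_eq_prod]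
  · rfl
  · rw [List.nodup_cons, List.mem_ofFn, List.nodup_ofFn]
    exact ⟨fun ⟨j, hj⟩ => h0 j hj, ha⟩

theorem zeroSwap_apply_of_ne {a x : ℕ} (h0 : x ≠ 0) (ha : x ≠ a) :
    (zeroSwap a : Equiv.Perm ℕ) x = x := Equiv.swap_apply_of_ne_of_ne h0 ha

theorem swapProd_cons_apply (a : ℕ) (l : List ℕ) (x : ℕ) :
    (swapProd (a :: l) : Equiv.Perm ℕ) x
      = (zeroSwap a : Equiv.Perm ℕ) ((swapProd l : Equiv.Perm ℕ) x) := by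
  rw [swapProd_cons]; rfl

theorem swapProd_apply_of_notMem {x : ℕ} (h0 : x ≠ 0) {l : List ℕ} (h : x ∉ l) :
    (swapProd l : Equiv.Perm ℕ) x = x := by
  induction l with
  | nil => rfl
  | cons a l ih =>
    rw [List.mem_cons, not_or] at h
    rw [swapProd_cons_apply, ih h.2, zeroSwap_apply_of_ne h0 h.1]

/-- If a letter occurs exactly once, then it is moved. -/
theorem swapProd_apply_ne_of_count_eq_one {x : ℕ} (h0 : x ≠ 0) {l : List ℕ} (h : l.count x = 1) :
    (swapProd l : Equiv.Perm ℕ) x ≠ x := by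
  induction l with
  | nil => simp at h
  | cons a l ih =>
    rw [swapProd_cons_apply]
    by_cases hax : a = x
    · subst hax
      have : a ∉ l := by
        exact List.count_eq_zero.1 (by simpa using h)
      rw [swapProd_apply_of_notMem h0 this]
      change Equiv.swap 0 a a ≠ a
      rw [Equiv.swap_apply_right]; exact h0.symm
    · rw [List.count_cons_of_ne hax] at h
      intro e
      refine ih h ((zeroSwap a : Equiv.Perm ℕ).injective ?_)
      rw [e, zeroSwap_apply_of_ne h0 (Ne.symm hax)]

theorem two_le_count_of_swapProd_eq_one {l : List ℕ} (hl : 0 ∉ l) (h : swapProd l = 1) {x : ℕ}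
    (hx : x ∈ l) : 2 ≤ l.count x := by
  have h1 := List.count_pos_iff.2 hx
  by_contra hlt
  have h2 : l.count x = 1 := by omega
  refine swapProd_apply_ne_of_count_eq_one (fun e => hl (e ▸ hx)) h2 ?_
  rw [h]; rfl

/-- A letter occurring once would be moved, so every letter occurs at least twice. -/
theorem card_toFinset_le_half {l : List ℕ} (hl : 0 ∉ l) (h : swapProd l = 1) :
    l.toFinset.card ≤ l.length / 2 := by
  have : l.toFinset.card * 2 ≤ ∑ x ∈ l.toFinset, l.count x := by
    rw [← smul_eq_mul]
    exact Finset.card_nsmul_le_sum _ _ _ fun x hx =>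
      two_le_count_of_swapProd_eq_one hl h (List.mem_toFinset.1 hx)
  rw [List.sum_toFinset_count_eq_length] at this
  omega

theorem swapProd_apply_ne_zero_of_mem_tail {a x : ℕ} {l : List ℕ} (h0 : 0 ∉ a :: l)
    (hn : (a :: l).Nodup) (hx : x ∈ l) : (swapProd (a :: l) : Equiv.Perm ℕ) x ≠ 0 := by
  rw [List.mem_cons, not_or] at h0
  rw [List.nodup_cons] at hn
  rw [swapProd_cons_apply]
  intro e
  have e' : (swapProd l : Equiv.Perm ℕ) x = a := by
    have : (zeroSwap a : Equiv.Perm ℕ) a = 0 := Equiv.swap_apply_right 0 a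
    exact (zeroSwap a : Equiv.Perm ℕ).injective (e.trans this.symm)
  have : x = a := (swapProd l : Equiv.Perm ℕ).injective
    (e'.trans (swapProd_apply_of_notMem (Ne.symm h0.1) hn.1).symm)
  exact hn.1 (this ▸ hx)

/-- Multiplying the cycle of a list without repetitions by the transposition `(0 b)`, where `b` is
a letter of the tail, still moves all letters. -/
theorem swapProd_cons_apply_ne {a b x : ℕ} {l : List ℕ} (h0 : 0 ∉ a :: l)
    (hn : (a :: l).Nodup) (hb : b ∈ l) (hx : x ∈ a :: l) :
    (swapProd (b :: a :: l) : Equiv.Perm ℕ) x ≠ x := by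
  have hx0 : x ≠ 0 := fun e => h0 (e ▸ hx)
  have hc := swapProd_apply_ne_of_count_eq_one hx0 (List.count_eq_one_of_mem hn hx)
  rw [swapProd_cons_apply]
  intro e
  by_cases hxb : x = b
  · subst hxb
    -- If `x = b` were fixed, the cycle would send `b` to `0`; but only the head `a` is sent to `0`.
    refine swapProd_apply_ne_zero_of_mem_tail h0 hn hb ((zeroSwap x : Equiv.Perm ℕ).injective ?_)
    rw [e]
    exact (Equiv.swap_apply_left 0 x).symm
  · refine hc ((zeroSwap b : Equiv.Perm ℕ).injective ?_)
    rw [e, zeroSwap_apply_of_ne hx0 hxb]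

/-- All letters of `l` are moved, while the right-hand side can move only `0` and letters of `l'`. A
permutation thus has boundedly many representations of a given length by lists without repetitions.
-/
theorem subset_of_swapProd_eq {l l' : List ℕ} (h0 : 0 ∉ l) (hn : l.Nodup)
    (h : swapProd l = swapProd l') : l ⊆ l' := fun x hx => by
  by_contra hx'
  have hx0 : x ≠ 0 := fun e => h0 (e ▸ hx)
  refine swapProd_apply_ne_of_count_eq_one hx0 (List.count_eq_one_of_mem hn hx) ?_
  rw [h, swapProd_apply_of_notMem hx0 hx']

theorem subset_of_swapProd_cons_eq {b b' : ℕ} {l l' : List ℕ} (h0 : 0 ∉ l) (hn : l.Nodup)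
    (hb : b ∈ l.tail) (hb' : b' ∈ l') (h : swapProd (b :: l) = swapProd (b' :: l')) : l ⊆ l' := by
  intro x hx
  cases l with
  | nil => simp at hx
  | cons a l =>
    by_contra hx'
    have hx0 : x ≠ 0 := fun e => h0 (e ▸ hx)
    refine swapProd_cons_apply_ne h0 hn hb hx ?_
    rw [h, swapProd_apply_of_notMem hx0]
    rw [List.mem_cons, not_or]
    exact ⟨fun e => hx' (e ▸ hb'), hx'⟩

end Cycles

/-! ### Counting lists with given letters -/

section Lists

/-- The lists of length `m` with letters in `A`. -/
def listsOver (A : Finset ℕ) : ℕ → Finset (List ℕ)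
  | 0 => {[]}
  | m + 1 => (A ×ˢ listsOver A m).image fun q => q.1 :: q.2

theorem mem_listsOver {A : Finset ℕ} {m : ℕ} {l : List ℕ} :
    l ∈ listsOver A m ↔ l.length = m ∧ ∀ x ∈ l, x ∈ A := by
  induction m generalizing l with
  | zero => simp +contextual [listsOver, List.length_eq_zero_iff]
  | succ m ih =>
    cases l with
    | nil => simp [listsOver]
    | cons a l => simp [listsOver, ih]; tauto

theorem card_listsOver_le (A : Finset ℕ) (m : ℕ) : (listsOver A m).card ≤ A.card ^ m := by
  induction m with
  | zero => simp [listsOver]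
  | succ m ih =>
    refine Finset.card_image_le.trans ?_
    rw [Finset.card_product, pow_succ']
    exact Nat.mul_le_mul_left _ ih

theorem sum_zeroSwap_pow (A : Finset ℕ) (m : ℕ) :
    (∑ b ∈ A, MonoidAlgebra.of ℂ finPerm (zeroSwap b)) ^ m
      = ∑ l ∈ listsOver A m, MonoidAlgebra.of ℂ finPerm (swapProd l) := by
  induction m with
  | zero => simp [listsOver, MonoidAlgebra.one_def]
  | succ m ih =>
    rw [pow_succ', ih, Finset.sum_mul_sum, ← Finset.sum_product', listsOver, Finset.sum_image]
    · simp only [swapProd_cons, map_mul]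
    · rintro ⟨a, l⟩ _ ⟨a', l'⟩ _ h
      simpa using h

/-- A list with at most `k` distinct letters is encoded by an alphabet `Fin k → A` and, for each
position, the number of its letter in the alphabet. -/
theorem card_listsOver_filter_le (A : Finset ℕ) {m k : ℕ} (hkm : k ≤ m) :
    ((listsOver A m).filter fun l => l.toFinset.card ≤ k).card ≤ A.card ^ k * k ^ m := by
  classical
  have h : ((listsOver A m).filter fun l => l.toFinset.card ≤ k) ⊆
      (Finset.univ : Finset ((Fin k → A) × (Fin m → Fin k))).image
        fun q => List.ofFn fun j => ((q.1 (q.2 j) : A) : ℕ) := by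
    intro l hl
    rw [Finset.mem_filter, mem_listsOver] at hl
    obtain ⟨⟨rfl, hA⟩, hk⟩ := hl
    rw [Finset.mem_image]
    let e := l.toFinset.equivFin
    rcases l.length.eq_zero_or_pos with h0 | hpos
    · rw [List.length_eq_zero_iff] at h0
      subst h0
      obtain rfl : k = 0 := by simpa using hkm
      exact ⟨(Fin.elim0, Fin.elim0), Finset.mem_univ _, rfl⟩
    -- `x0` fills the alphabet entries beyond the distinct letters of `l`; it needs a first letter,
    -- hence the separate case of the empty list.
    · let x0 : A := ⟨l[0], hA _ (List.getElem_mem _)⟩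
      refine ⟨(fun j => if hj : (j : ℕ) < l.toFinset.card then
          ⟨e.symm ⟨j, hj⟩, hA _ (List.mem_toFinset.1 (e.symm ⟨j, hj⟩).2)⟩ else x0,
        fun j => Fin.castLE hk (e ⟨l[j], List.mem_toFinset.2 (List.getElem_mem _)⟩)),
        Finset.mem_univ _, ?_⟩
      apply List.ext_getElem
      · simp
      · intro j h1 h2
        simp
  refine (Finset.card_le_card h).trans (Finset.card_image_le.trans ?_)
  simp [Fintype.card_prod]

theorem norm_coeff_one_sum_zeroSwap_pow_le (N m : ℕ) :
    ‖((∑ b ∈ Finset.Icc 1 N, MonoidAlgebra.of ℂ finPerm (zeroSwap b)) ^ m).coeff 1‖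
      ≤ (N : ℝ) ^ (m / 2) * ((m / 2 : ℕ) : ℝ) ^ m := by
  classical
  have h := card_listsOver_filter_le (Finset.Icc 1 N) (Nat.div_le_self m 2)
  rw [Nat.card_Icc, Nat.add_sub_cancel] at h
  have h1 := coeff_sum_smul_of (listsOver (Finset.Icc 1 N) m) (fun _ => 1) swapProd 1
  simp only [one_smul, Finset.sum_const, nsmul_eq_mul, mul_one] at h1
  rw [sum_zeroSwap_pow, h1, Complex.norm_natCast]
  norm_cast
  refine le_trans (Finset.card_le_card fun l hl => ?_) h
  rw [Finset.mem_filter] at hl ⊢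
  refine ⟨hl.1, ?_⟩
  have hl1 := mem_listsOver.1 hl.1
  rw [← hl1.1]
  refine card_toFinset_le_half (fun h0 => ?_) hl.2
  simpa using hl1.2 0 h0

variable {ι : Type*}

/-- The lists `a` without repetitions such that the `j`-th letter of `a` belongs to the set which
is indexed by the `j`-th letter of a word. -/
def nodupLists (I : ι → Finset ℕ) : List ι → Finset (List ℕ)
  | [] => {[]}
  | i :: w => (nodupLists I w).biUnion fun a => (I i \ a.toFinset).image (· :: a)

theorem mem_nodupLists {I : ι → Finset ℕ} {w : List ι} {a : List ℕ} :
    a ∈ nodupLists I w ↔ a.Nodup ∧ List.Forall₂ (fun b i => b ∈ I i) a w := by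
  induction w generalizing a with
  | nil => simp +contextual [nodupLists]
  | cons i w ih =>
    cases a with
    | nil => simp [nodupLists]
    | cons b a => simp [nodupLists, ih]; tauto

theorem sum_nodupLists_cons {V : Type*} [AddCommMonoid V] (I : ι → Finset ℕ) (i : ι) (w : List ι)
    (f : List ℕ → V) :
    ∑ l ∈ nodupLists I (i :: w), f l
      = ∑ a ∈ nodupLists I w, ∑ b ∈ I i \ a.toFinset, f (b :: a) := by
  rw [nodupLists, Finset.sum_biUnion]
  · refine Finset.sum_congr rfl fun a _ => Finset.sum_image ?_
    intro b _ b' _ h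
    simpa using h
  · intro a _ a' _ h
    refine Finset.disjoint_left.2 fun l hl hl' => h ?_
    simp only [Finset.mem_image] at hl hl'
    obtain ⟨b, _, rfl⟩ := hl
    obtain ⟨b', _, h'⟩ := hl'
    simp_all

theorem nodupLists_subset {I : ι → Finset ℕ} {A : Finset ℕ} (hI : ∀ i, I i ⊆ A) (w : List ι) :
    nodupLists I w ⊆ listsOver A w.length := fun a ha => by
  rw [mem_nodupLists] at ha
  rw [mem_listsOver]
  refine ⟨ha.2.length_eq, fun x hx => ?_⟩
  have := ha.2
  clear ha
  induction this with
  | nil => simp at hx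
  | cons h _ ih =>
    rw [List.mem_cons] at hx
    rcases hx with rfl | hx
    · exact hI _ h
    · exact ih hx

theorem card_nodupLists_le {I : ι → Finset ℕ} {N : ℕ} (hI : ∀ i, I i ⊆ Finset.Icc 1 N)
    (w : List ι) : (nodupLists I w).card ≤ N ^ w.length := by
  have := (Finset.card_le_card (nodupLists_subset hI w)).trans (card_listsOver_le _ _)
  simpa using this

theorem zero_notMem_of_mem_nodupLists {I : ι → Finset ℕ} {N : ℕ}
    (hI : ∀ i, I i ⊆ Finset.Icc 1 N) {w : List ι} {a : List ℕ} (ha : a ∈ nodupLists I w) :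
    0 ∉ a := fun h => by
  simpa using (mem_listsOver.1 (nodupLists_subset hI w ha)).2 0 h

end Lists

/-! ### Sums of cycles indexed by words, and their products -/

section WordSums

variable {ι : Type*}

/-- The sum of the cycles `(0 a₁) ⋯ (0 a_m)` over the lists `a` without repetitions with
`a_j ∈ I (w_j)`, normalized by `c ^ m`. -/
noncomputable def wordSum (I : ι → Finset ℕ) (c : ℝ) (w : List ι) : MonoidAlgebra ℂ finPerm :=
  ((c ^ w.length : ℝ) : ℂ) • ∑ a ∈ nodupLists I w, MonoidAlgebra.of ℂ finPerm (swapProd a)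

@[simp] theorem wordSum_nil (I : ι → Finset ℕ) (c : ℝ) : wordSum I c [] = 1 := by
  simp [wordSum, nodupLists, MonoidAlgebra.one_def]

theorem wordSum_singleton (I : ι → Finset ℕ) (c : ℝ) (i : ι) :
    wordSum I c [i] = (c : ℂ) • ∑ b ∈ I i, MonoidAlgebra.of ℂ finPerm (zeroSwap b) := by
  rw [wordSum, sum_nodupLists_cons]
  simp [nodupLists]

theorem star_wordSum (I : ι → Finset ℕ) (c : ℝ) (w : List ι) :
    star (wordSum I c w) = wordSum I c w.reverse := by
  rw [wordSum, wordSum, star_smul, star_sum, List.length_reverse]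
  congr 1
  · simp
  · refine Finset.sum_bij' (fun a _ => a.reverse) (fun a _ => a.reverse) ?_ ?_ ?_ ?_ ?_
    · intro a ha
      rw [mem_nodupLists] at ha ⊢
      exact ⟨List.nodup_reverse.2 ha.1, List.rel_reverse ha.2⟩
    · intro a ha
      rw [mem_nodupLists] at ha ⊢
      exact ⟨List.nodup_reverse.2 ha.1, by simpa using List.rel_reverse ha.2⟩
    · simp
    · simp
    · intro a _
      rw [MonoidAlgebra.of_apply, groupAlgebra_star_single, inv_swapProd, star_one]; rfl

/-- The product over a nonempty list without repetitions moves its letters, hence is not the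
identity. -/
theorem coeff_one_wordSum {I : ι → Finset ℕ} {N : ℕ} (hI : ∀ i, I i ⊆ Finset.Icc 1 N) (c : ℝ)
    {w : List ι} (hw : w ≠ []) : (wordSum I c w).coeff 1 = 0 := by
  classical
  have h1 := coeff_sum_smul_of (nodupLists I w) (fun _ => 1) swapProd 1
  simp only [one_smul] at h1
  rw [wordSum, MonoidAlgebra.coeff_smul, Finsupp.smul_apply, h1, Finset.filter_false_of_mem]
  · simp
  · intro a ha h
    have h0 := zero_notMem_of_mem_nodupLists hI ha
    rw [mem_nodupLists] at ha
    have hsub := subset_of_swapProd_eq h0 ha.1 (h.trans swapProd_nil.symm)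
    obtain rfl := List.subset_nil.1 hsub
    exact hw (List.forall₂_nil_left_iff.1 ha.2)

/-- The terms of a product of two sums of cycles in which a letter of the tail is repeated. -/
noncomputable def repeatSum (I : ι → Finset ℕ) (i : ι) (w : List ι) : MonoidAlgebra ℂ finPerm :=
  ∑ q ∈ (nodupLists I w).sigma fun a => I i ∩ a.tail.toFinset,
    MonoidAlgebra.of ℂ finPerm (swapProd (q.2 :: q.1))

/-- The letter `b` is one of the letters of `a`, so there are at most `|w| N^|w|` terms. All letters
of `a` remain moved, so the fibres are bounded in terms of `|w|` alone. The normalization for words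
of length `|w| + 1` allows one more factor `N`, which is why these terms vanish in the limit. -/
theorem l2sq_repeatSum_le {I : ι → Finset ℕ} {N : ℕ} (hI : ∀ i, I i ⊆ Finset.Icc 1 N)
    (i : ι) (w : List ι) :
    l2sq (repeatSum I i w) ≤ (w.length ^ w.length * w.length * w.length : ℕ) * N ^ w.length := by
  classical
  set S := (nodupLists I w).sigma fun a => I i ∩ a.tail.toFinset with hS
  have hlen : ∀ a ∈ nodupLists I w, a.length = w.length := fun a ha =>
    (mem_nodupLists.1 ha).2.length_eq
  have hcard : S.card ≤ w.length * N ^ w.length := by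
    rw [hS, Finset.card_sigma, mul_comm]
    refine (Finset.sum_le_card_nsmul _ _ w.length fun a ha => ?_).trans
      (Nat.mul_le_mul_right _ (card_nodupLists_le hI w))
    refine (Finset.card_le_card Finset.inter_subset_right).trans
      ((List.toFinset_card_le _).trans ?_)
    rw [List.length_tail, hlen a ha]; omega
  have hfib : ∀ h, (S.filter fun q => swapProd (q.2 :: q.1) = h).card
      ≤ w.length ^ w.length * w.length := by
    intro h
    rcases (S.filter fun q => swapProd (q.2 :: q.1) = h).eq_empty_or_nonempty with he | ⟨q', hq'⟩
    · rw [he]; simp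
    have hA : q'.1.toFinset.card ≤ w.length := by
      rw [Finset.mem_filter, hS, Finset.mem_sigma] at hq'
      exact (List.toFinset_card_le _).trans (hlen _ hq'.1.1).le
    have hsub : (S.filter fun q => swapProd (q.2 :: q.1) = h) ⊆
        (listsOver q'.1.toFinset w.length).sigma fun _ => q'.1.toFinset := by
      intro q hq
      rw [Finset.mem_filter, hS, Finset.mem_sigma, Finset.mem_inter, List.mem_toFinset] at hq hq'
      have hss : q.1 ⊆ q'.1 := subset_of_swapProd_cons_eq
        (zero_notMem_of_mem_nodupLists hI hq.1.1) (mem_nodupLists.1 hq.1.1).1 hq.1.2.2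
        (List.mem_of_mem_tail hq'.1.2.2) (hq.2.trans hq'.2.symm)
      rw [Finset.mem_sigma, mem_listsOver]
      exact ⟨⟨hlen _ hq.1.1, fun x hx => List.mem_toFinset.2 (hss hx)⟩,
        List.mem_toFinset.2 (hss (List.mem_of_mem_tail hq.1.2.2))⟩
    refine (Finset.card_le_card hsub).trans ?_
    rw [Finset.card_sigma, Finset.sum_const, smul_eq_mul]
    exact Nat.mul_le_mul ((card_listsOver_le _ _).trans (Nat.pow_le_pow_left hA _)) hA
  have h := l2sq_sum_le S (fun _ => 1) (fun q => swapProd (q.2 :: q.1)) _ hfib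
  simp only [one_smul, norm_one, one_pow, Finset.sum_const, nsmul_eq_mul, mul_one] at h
  calc _ ≤ _ := h
    _ ≤ (w.length ^ w.length * w.length : ℕ) * ((w.length * N ^ w.length : ℕ) : ℝ) := by gcongr
    _ = _ := by push_cast; ring

theorem l2sq_nodup_sum_le {I : ι → Finset ℕ} {N : ℕ} (hI : ∀ i, I i ⊆ Finset.Icc 1 N)
    (w : List ι) (c : List ℕ → ℂ) {δ : ℝ} (hc : ∀ a ∈ nodupLists I w, ‖c a‖ ≤ δ) :
    l2sq (∑ a ∈ nodupLists I w, c a • MonoidAlgebra.of ℂ finPerm (swapProd a))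
      ≤ (w.length ^ w.length : ℕ) * (N ^ w.length * δ ^ 2) := by
  classical
  have hlen : ∀ a ∈ nodupLists I w, a.length = w.length := fun a ha =>
    (mem_nodupLists.1 ha).2.length_eq
  have hfib : ∀ h, ((nodupLists I w).filter fun a => swapProd a = h).card
      ≤ w.length ^ w.length := by
    intro h
    rcases ((nodupLists I w).filter fun a => swapProd a = h).eq_empty_or_nonempty with
      he | ⟨a', ha'⟩
    · rw [he]; simp
    rw [Finset.mem_filter] at ha'
    have hsub : ((nodupLists I w).filter fun a => swapProd a = h) ⊆
        listsOver a'.toFinset w.length := by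
      intro a ha
      rw [Finset.mem_filter] at ha
      have hss : a ⊆ a' := subset_of_swapProd_eq
        (zero_notMem_of_mem_nodupLists hI ha.1) (mem_nodupLists.1 ha.1).1 (ha.2.trans ha'.2.symm)
      rw [mem_listsOver]
      exact ⟨hlen _ ha.1, fun x hx => List.mem_toFinset.2 (hss hx)⟩
    refine (Finset.card_le_card hsub).trans ((card_listsOver_le _ _).trans ?_)
    exact Nat.pow_le_pow_left ((List.toFinset_card_le _).trans (hlen _ ha'.1).le) _
  refine (l2sq_sum_le _ c swapProd _ hfib).trans ?_
  gcongr
  calc _ ≤ ∑ a ∈ nodupLists I w, δ ^ 2 := by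
        refine Finset.sum_le_sum fun a ha => ?_
        exact pow_le_pow_left₀ (norm_nonneg _) (hc a ha) 2
    _ ≤ _ := by
        rw [Finset.sum_const, nsmul_eq_mul]
        gcongr
        exact_mod_cast card_nodupLists_le hI w

theorem wordSum_singleton_mul (I : ι → Finset ℕ) (c : ℝ) (i : ι) (w : List ι) :
    wordSum I c [i] * wordSum I c w = wordSum I c (i :: w)
      + ((c ^ (w.length + 1) : ℝ) : ℂ) • ∑ a ∈ nodupLists I w, ∑ b ∈ I i ∩ a.toFinset,
          MonoidAlgebra.of ℂ finPerm (swapProd (b :: a)) := by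
  rw [wordSum_singleton, wordSum, wordSum, sum_nodupLists_cons, smul_mul_smul_comm,
    List.length_cons, ← smul_add, ← Finset.sum_add_distrib, Finset.sum_mul_sum, Finset.sum_comm]
  congr 1
  · push_cast; ring
  · refine Finset.sum_congr rfl fun a _ => ?_
    rw [← Finset.sum_union (Finset.disjoint_sdiff_inter _ _), Finset.sdiff_union_inter]
    simp

/-- A letter of `I i` differs from the head, which lies in `I j`, so it can be repeated only from
the tail. -/
theorem wordSum_singleton_mul_cons_of_disjoint {I : ι → Finset ℕ} (c : ℝ) {i j : ι}
    (hij : Disjoint (I i) (I j)) (w : List ι) :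
    wordSum I c [i] * wordSum I c (j :: w) = wordSum I c (i :: j :: w)
      + ((c ^ (w.length + 2) : ℝ) : ℂ) • repeatSum I i (j :: w) := by
  rw [wordSum_singleton_mul, repeatSum, Finset.sum_sigma]
  congr 2
  rw [sum_nodupLists_cons, sum_nodupLists_cons]
  refine Finset.sum_congr rfl fun a _ => Finset.sum_congr rfl fun b hb => ?_
  refine Finset.sum_congr ?_ fun _ _ => rfl
  rw [List.toFinset_cons, Finset.inter_insert_of_notMem, List.tail_cons]
  exact Finset.disjoint_right.1 hij (Finset.mem_sdiff.1 hb).1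

/-- The additional last term comes from `b` equal to the head: then `(0 b)(0 b) = 1`, and the
removed head had `|I i \ a|` possible values. -/
theorem wordSum_singleton_mul_cons_self (I : ι → Finset ℕ) (c : ℝ) (i : ι) (w : List ι) :
    wordSum I c [i] * wordSum I c (i :: w) = wordSum I c (i :: i :: w)
      + ((c ^ (w.length + 2) : ℝ) : ℂ) • (repeatSum I i (i :: w)
        + ∑ a ∈ nodupLists I w, ((I i \ a.toFinset).card : ℂ) •
          MonoidAlgebra.of ℂ finPerm (swapProd a)) := by
  rw [wordSum_singleton_mul, repeatSum, Finset.sum_sigma]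
  congr 2
  rw [sum_nodupLists_cons, sum_nodupLists_cons, ← Finset.sum_add_distrib]
  refine Finset.sum_congr rfl fun a _ => ?_
  rw [Nat.cast_smul_eq_nsmul, ← Finset.sum_const, ← Finset.sum_add_distrib]
  refine Finset.sum_congr rfl fun b hb => ?_
  rw [Finset.mem_sdiff, List.mem_toFinset] at hb
  rw [List.toFinset_cons, Finset.inter_insert_of_mem hb.1, Finset.sum_insert, List.tail_cons,
    add_comm, swapProd_cons, swapProd_cons, ← mul_assoc, zeroSwap_mul_self, one_mul]
  simp [hb.2]

end WordSums

/-! ### Moment bounds by domination -/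

section Domination

variable {ι : Type*}

theorem wordSum_mem_nonnegCoeff (I : ι → Finset ℕ) {c : ℝ} (hc : 0 ≤ c) (w : List ι) :
    wordSum I c w ∈ nonnegCoeff finPerm :=
  smul_mem_nonnegCoeff (by positivity) (sum_mem fun _ _ => of_mem_nonnegCoeff _)

/-- The power expands as a sum over all lists with letters in `[1, N]`; the difference keeps those
outside `nodupLists`. -/
theorem pow_sub_wordSum_mem_nonnegCoeff {I : ι → Finset ℕ} {N : ℕ}
    (hI : ∀ i, I i ⊆ Finset.Icc 1 N) {c : ℝ} (hc : 0 ≤ c) (w : List ι) :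
    ((c : ℂ) • ∑ b ∈ Finset.Icc 1 N, MonoidAlgebra.of ℂ finPerm (zeroSwap b)) ^ w.length
      - wordSum I c w ∈ nonnegCoeff finPerm := by
  classical
  rw [smul_pow, sum_zeroSwap_pow, wordSum, ← Complex.ofReal_pow, ← smul_sub,
    ← Finset.sum_sdiff (nodupLists_subset hI w), add_sub_cancel_right]
  exact smul_mem_nonnegCoeff (by positivity) (sum_mem fun _ _ => of_mem_nonnegCoeff _)

theorem prod_wordSum_mem_nonnegCoeff {I : ι → Finset ℕ} {N : ℕ}
    (hI : ∀ i, I i ⊆ Finset.Icc 1 N) {c : ℝ} (hc : 0 ≤ c) (L : List (List ι)) :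
    (L.map (wordSum I c)).prod ∈ nonnegCoeff finPerm ∧
    ((c : ℂ) • ∑ b ∈ Finset.Icc 1 N, MonoidAlgebra.of ℂ finPerm (zeroSwap b)) ^ L.flatten.length
      - (L.map (wordSum I c)).prod ∈ nonnegCoeff finPerm := by
  induction L with
  | nil => simp [one_mem, zero_mem]
  | cons w L ih =>
    rw [List.map_cons, List.prod_cons, List.flatten_cons, List.length_append, pow_add]
    exact ⟨mul_mem (wordSum_mem_nonnegCoeff I hc w) ih.1,
      mul_sub_mul_mem_nonnegCoeff (wordSum_mem_nonnegCoeff I hc w)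
        (pow_sub_wordSum_mem_nonnegCoeff hI hc w) ih.1 ih.2⟩

theorem norm_coeff_one_prod_wordSum_le {I : ι → Finset ℕ} {N : ℕ}
    (hI : ∀ i, I i ⊆ Finset.Icc 1 N) {c : ℝ} (hc : 0 ≤ c) (L : List (List ι)) :
    ‖(L.map (wordSum I c)).prod.coeff 1‖ ≤ c ^ L.flatten.length *
      ((N : ℝ) ^ (L.flatten.length / 2) *
        ((L.flatten.length / 2 : ℕ) : ℝ) ^ L.flatten.length) := by
  obtain ⟨h1, h2⟩ := prod_wordSum_mem_nonnegCoeff hI hc L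
  have h1 := h1 1
  have h2 := h2 1
  rw [MonoidAlgebra.coeff_sub, Finsupp.sub_apply, sub_nonneg] at h2
  refine (CStarAlgebra.norm_le_norm_of_nonneg_of_le h1 h2).trans ?_
  rw [smul_pow, MonoidAlgebra.coeff_smul, Finsupp.smul_apply, norm_smul, norm_pow,
    Complex.norm_real, Real.norm_of_nonneg hc]
  gcongr
  exact norm_coeff_one_sum_zeroSwap_pow_le N _

/-- The squared norm is the trace of `x x*`, and `x*` is again a product of word sums, of the
reversed words; the trace bound applies with twice the length. -/
theorem l2sq_prod_wordSum_le {I : ι → Finset ℕ} {N : ℕ}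
    (hI : ∀ i, I i ⊆ Finset.Icc 1 N) {c : ℝ} (hc : 0 ≤ c) (L : List (List ι)) :
    l2sq (L.map (wordSum I c)).prod ≤ c ^ (2 * L.flatten.length) *
      ((N : ℝ) ^ L.flatten.length * (L.flatten.length : ℝ) ^ (2 * L.flatten.length)) := by
  have hstar : star (L.map (wordSum I c)).prod
      = (((L.map List.reverse).reverse).map (wordSum I c)).prod := by
    induction L with
    | nil => simp
    | cons w L ih => simp [ih, star_wordSum]
  have hlen : (L ++ (L.map List.reverse).reverse).flatten.length = 2 * L.flatten.length := by
    simp [List.length_flatten, Function.comp_def, two_mul]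
  have h := norm_coeff_one_prod_wordSum_le hI hc (L ++ (L.map List.reverse).reverse)
  rw [hlen, Nat.mul_div_cancel_left _ two_pos, List.map_append, List.prod_append, ← hstar,
    ← coe_l2sq, Complex.norm_real] at h
  exact (Real.le_norm_self _).trans h

end Domination

/-- For every `n`, a family of pairwise disjoint finite sets `idx i n` of positive integers which
are bounded by a multiple of `n`, and such that the cardinality of `idx i n` is asymptotically
proportional to `n`. -/
structure IndexSystem (ι : Type*) where
  idx : ι → ℕ → Finset ℕ
  top : ℕ → ℕ
  growth : ℝ
  density : ι → ℝ
  disjoint : ∀ n i j, i ≠ j → Disjoint (idx i n) (idx j n)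
  subset : ∀ n i, idx i n ⊆ Finset.Icc 1 (top n)
  top_le : ∀ n, (top n : ℝ) ≤ growth * n
  tendsto : ∀ i, Tendsto (fun n => ((idx i n).card : ℝ) / n) atTop (𝓝 (density i))

/-! ### Null and bounded sequences in `ℓ²` -/

section Sequences

variable {G : Type*} [Group G]

/-- The sequences which tend to `0` in `ℓ²`-norm. -/
noncomputable def l2Null (G : Type*) [Group G] : Submodule ℂ (ℕ → MonoidAlgebra ℂ G) where
  carrier := {x | Tendsto (fun n => l2sq (x n)) atTop (𝓝 0)}
  zero_mem' := by simp [l2sq]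
  add_mem' {x y} hx hy := by
    have h := (Tendsto.const_mul 2 hx).add (Tendsto.const_mul 2 hy)
    rw [mul_zero, add_zero] at h
    exact squeeze_zero (fun n => l2sq_nonneg _) (fun n => l2sq_add_le _ _) h
  smul_mem' c x hx := by
    have h := Tendsto.const_mul (‖c‖ ^ 2) hx
    rw [mul_zero] at h
    exact h.congr fun n => (l2sq_smul c (x n)).symm

/-- The sequences which are eventually bounded in `ℓ²`-norm. -/
noncomputable def l2Bounded (G : Type*) [Group G] : Submodule ℂ (ℕ → MonoidAlgebra ℂ G) where
  carrier := {x | ∃ C : ℝ, ∀ᶠ n in atTop, l2sq (x n) ≤ C}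
  zero_mem' := ⟨0, by simp [l2sq]⟩
  add_mem' := by
    rintro x y ⟨C, hC⟩ ⟨D, hD⟩
    refine ⟨2 * C + 2 * D, ?_⟩
    filter_upwards [hC, hD] with n h1 h2
    exact (l2sq_add_le _ _).trans (by linarith)
  smul_mem' := by
    rintro c x ⟨C, hC⟩
    refine ⟨‖c‖ ^ 2 * C, ?_⟩
    filter_upwards [hC] with n h
    rw [Pi.smul_apply, l2sq_smul]
    gcongr

theorem mul_mem_l2Null {b x : ℕ → MonoidAlgebra ℂ G} (hb : star b * (b * x) ∈ l2Bounded G)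
    (hx : x ∈ l2Null G) : b * x ∈ l2Null G := by
  obtain ⟨C, hC⟩ := hb
  have h : Tendsto (fun n => √(C * l2sq (x n))) atTop (𝓝 0) := by
    have := (Tendsto.const_mul C hx).sqrt
    simpa using this
  refine squeeze_zero' (Eventually.of_forall fun n => l2sq_nonneg _) ?_ h
  filter_upwards [hC] with n hn
  refine Real.le_sqrt_of_sq_le ((l2sq_mul_sq_le _ _).trans ?_)
  exact mul_le_mul_of_nonneg_right hn (l2sq_nonneg _)

theorem star_mem_l2Null {x : ℕ → MonoidAlgebra ℂ G} (hx : x ∈ l2Null G) : star x ∈ l2Null G :=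
  Tendsto.congr (fun n => (l2sq_star (x n)).symm) hx

theorem tendsto_coeff_one_of_mem_l2Null {x : ℕ → MonoidAlgebra ℂ G} (hx : x ∈ l2Null G) :
    Tendsto (fun n => (x n).coeff 1) atTop (𝓝 0) := by
  have h := Filter.Tendsto.sqrt hx
  rw [Real.sqrt_zero] at h
  exact squeeze_zero_norm (fun n => Real.le_sqrt_of_sq_le (norm_coeff_one_sq_le _)) h

end Sequences

/-! ### The asymptotic multiplication rule -/

namespace IndexSystem

variable {ι : Type*} (S : IndexSystem ι)

/-- The sequence of normalized sums of cycles which is attached to a word. -/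
noncomputable def cycleSeq (w : List ι) (n : ℕ) : MonoidAlgebra ℂ finPerm :=
  wordSum (fun i => S.idx i n) (√n)⁻¹ w

theorem cycleSeq_nil : S.cycleSeq [] = 1 := funext fun _ => wordSum_nil _ _

theorem star_cycleSeq (w : List ι) : star (S.cycleSeq w) = S.cycleSeq w.reverse :=
  funext fun _ => star_wordSum _ _ _

theorem pow_mul_top_pow_le {n : ℕ} (hn : 1 ≤ n) (m : ℕ) :
    ((√n)⁻¹ : ℝ) ^ (2 * m) * (S.top n : ℝ) ^ m ≤ S.growth ^ m := by
  have hn' : (0 : ℝ) < n := by exact_mod_cast hn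
  rw [pow_mul, inv_pow, Real.sq_sqrt hn'.le, ← mul_pow]
  refine pow_le_pow_left₀ (by positivity) ?_ m
  rw [inv_mul_le_iff₀ hn', mul_comm]
  exact S.top_le n

theorem prod_cycleSeq_mem_l2Bounded (L : List (List ι)) :
    (L.map S.cycleSeq).prod ∈ l2Bounded finPerm := by
  refine ⟨S.growth ^ L.flatten.length * (L.flatten.length : ℝ) ^ (2 * L.flatten.length), ?_⟩
  filter_upwards [eventually_ge_atTop 1] with n hn
  have h : (L.map S.cycleSeq).prod n
      = (L.map (wordSum (fun i => S.idx i n) (√n)⁻¹)).prod := by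
    have := map_list_prod (Pi.evalRingHom (fun _ : ℕ => MonoidAlgebra ℂ finPerm) n)
      (L.map S.cycleSeq)
    rw [List.map_map] at this
    exact this
  rw [h]
  refine (l2sq_prod_wordSum_le (S.subset n) (by positivity) L).trans ?_
  rw [← mul_assoc]
  gcongr
  exact S.pow_mul_top_pow_le hn _

theorem smul_repeatSum_mem_l2Null (i : ι) (w : List ι) :
    (fun n : ℕ => ((((√n)⁻¹ : ℝ) ^ (w.length + 1) : ℝ) : ℂ) • repeatSum (fun i => S.idx i n) i w)
      ∈ l2Null finPerm := by
  set K : ℝ := ((w.length ^ w.length * w.length * w.length : ℕ) : ℝ)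
  have hlim : Tendsto (fun n : ℕ => K * S.growth ^ w.length * ((n : ℝ))⁻¹) atTop (𝓝 0) := by
    simpa using (tendsto_inv_atTop_nhds_zero_nat (𝕜 := ℝ)).const_mul (K * S.growth ^ w.length)
  refine squeeze_zero' (Eventually.of_forall fun n => l2sq_nonneg _) ?_ hlim
  filter_upwards [eventually_ge_atTop 1] with n hn
  have hn' : (0 : ℝ) < n := by exact_mod_cast hn
  rw [l2sq_smul, Complex.norm_real, Real.norm_of_nonneg (by positivity)]
  calc _ ≤ (((√n)⁻¹ : ℝ) ^ (w.length + 1)) ^ 2 * (K * (S.top n : ℝ) ^ w.length) := by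
        gcongr
        exact l2sq_repeatSum_le (S.subset n) i w
    _ = K * (((√n)⁻¹ : ℝ) ^ (2 * w.length) * (S.top n : ℝ) ^ w.length) * ((√n)⁻¹) ^ 2 := by ring
    _ ≤ K * S.growth ^ w.length * ((√n)⁻¹) ^ 2 := by
        gcongr
        exact S.pow_mul_top_pow_le hn _
    _ = _ := by rw [inv_pow, Real.sq_sqrt hn'.le]

theorem singleton_mul_cycleSeq {i : ι} {w : List ι} (hw : w.head? ≠ some i) :
    S.cycleSeq [i] * S.cycleSeq w - S.cycleSeq (i :: w) ∈ l2Null finPerm := by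
  cases w with
  | nil => simp [cycleSeq_nil]
  | cons j w =>
    convert S.smul_repeatSum_mem_l2Null i (j :: w) using 1
    funext n
    have hij : i ≠ j := fun e => hw (by simp [e])
    rw [Pi.sub_apply, Pi.mul_apply, cycleSeq, cycleSeq, cycleSeq,
      wordSum_singleton_mul_cons_of_disjoint _ (S.disjoint n i j hij), add_sub_cancel_left]
    rfl

theorem singleton_mul_cycleSeq_cons (i : ι) (w : List ι) :
    S.cycleSeq [i] * S.cycleSeq (i :: w) - S.cycleSeq (i :: i :: w)
      - (S.density i : ℂ) • S.cycleSeq w ∈ l2Null finPerm := by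
  -- `x` is the error of replacing `|I i \ a| / n` by the density. Its coefficients are uniformly
  -- small, since removing the letters of `a` changes the cardinality by at most `|w|`.
  let x : ℕ → MonoidAlgebra ℂ finPerm := fun n =>
    ((((√n)⁻¹ : ℝ) ^ w.length : ℝ) : ℂ) • ∑ a ∈ nodupLists (fun i => S.idx i n) w,
      ((((√n)⁻¹ ^ 2 * ((S.idx i n \ a.toFinset).card : ℝ) - S.density i : ℝ)) : ℂ) •
        MonoidAlgebra.of ℂ finPerm (swapProd a)
  have hx : x ∈ l2Null finPerm := by
    set K : ℝ := ((w.length ^ w.length : ℕ) : ℝ)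
    let δ : ℕ → ℝ := fun n => |((S.idx i n).card : ℝ) / n - S.density i| + w.length * (n : ℝ)⁻¹
    have hδ : Tendsto δ atTop (𝓝 0) := by
      have h1 := ((S.tendsto i).sub_const (S.density i)).abs
      have h2 := (tendsto_inv_atTop_nhds_zero_nat (𝕜 := ℝ)).const_mul (w.length : ℝ)
      simpa using h1.add h2
    have hlim : Tendsto (fun n => K * S.growth ^ w.length * δ n ^ 2) atTop (𝓝 0) := by
      simpa using (hδ.pow 2).const_mul (K * S.growth ^ w.length)
    refine squeeze_zero' (Eventually.of_forall fun n => l2sq_nonneg _) ?_ hlim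
    filter_upwards [eventually_ge_atTop 1] with n hn
    have hn' : (0 : ℝ) < n := by exact_mod_cast hn
    have hc : ∀ a ∈ nodupLists (fun i => S.idx i n) w,
        ‖((((√n)⁻¹ ^ 2 * ((S.idx i n \ a.toFinset).card : ℝ) - S.density i : ℝ)) : ℂ)‖ ≤ δ n := by
      intro a ha
      rw [Complex.norm_real, Real.norm_eq_abs, inv_pow, Real.sq_sqrt hn'.le]
      have h1 : (S.idx i n \ a.toFinset).card ≤ (S.idx i n).card :=
        Finset.card_le_card Finset.sdiff_subset
      have h2 : (S.idx i n).card ≤ (S.idx i n \ a.toFinset).card + w.length := by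
        have := Finset.le_card_sdiff a.toFinset (S.idx i n)
        have := List.toFinset_card_le a
        rw [(mem_nodupLists.1 ha).2.length_eq] at this
        omega
      have h1' : ((S.idx i n \ a.toFinset).card : ℝ) ≤ (S.idx i n).card := by exact_mod_cast h1
      have h2' : ((S.idx i n).card : ℝ) ≤ (S.idx i n \ a.toFinset).card + w.length := by
        exact_mod_cast h2
      calc _ = |(((S.idx i n).card : ℝ) / n - S.density i) -
            (((S.idx i n).card : ℝ) - (S.idx i n \ a.toFinset).card) * (n : ℝ)⁻¹| := by
            congr 1; ring
        _ ≤ _ := abs_sub _ _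
        _ ≤ _ := by
            rw [abs_mul, abs_of_nonneg (sub_nonneg.2 h1'), abs_of_pos (inv_pos.2 hn')]
            exact add_le_add le_rfl (mul_le_mul_of_nonneg_right (by linarith) (by positivity))
    rw [l2sq_smul, Complex.norm_real, Real.norm_of_nonneg (by positivity)]
    calc _ ≤ (((√n)⁻¹ : ℝ) ^ w.length) ^ 2 * (K * ((S.top n : ℝ) ^ w.length * δ n ^ 2)) := by
          gcongr
          exact l2sq_nodup_sum_le (S.subset n) w _ hc
      _ = K * (((√n)⁻¹ : ℝ) ^ (2 * w.length) * (S.top n : ℝ) ^ w.length) * δ n ^ 2 := by ring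
      _ ≤ _ := by
          gcongr
          exact S.pow_mul_top_pow_le hn _
  convert (l2Null finPerm).add_mem (S.smul_repeatSum_mem_l2Null i (i :: w)) hx using 1
  funext n
  simp only [Pi.sub_apply, Pi.mul_apply, Pi.smul_apply, Pi.add_apply, cycleSeq, x]
  rw [wordSum_singleton_mul_cons_self, add_sub_cancel_left, smul_add, add_sub_assoc]
  congr 1
  rw [wordSum, smul_comm (S.density i : ℂ), pow_add, mul_comm, Complex.ofReal_mul, mul_smul,
    smul_comm _ (((√(n : ℝ))⁻¹ ^ w.length : ℝ) : ℂ), ← smul_sub, Finset.smul_sum,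
    Finset.smul_sum, ← Finset.sum_sub_distrib]
  congr 1
  refine Finset.sum_congr rfl fun a _ => ?_
  rw [smul_smul, ← sub_smul]
  push_cast
  rfl

end IndexSystem

/-! ### Calculus modulo null sequences -/

namespace IndexSystem

variable {ι : Type*} (S : IndexSystem ι)

/-- The `*`-algebra of sequences which is generated by the sums of cycles. -/
noncomputable def cycleAlgebra : StarSubalgebra ℂ (ℕ → MonoidAlgebra ℂ finPerm) where
  -- All words are taken as generators, since a word is a polynomial in the one-letter sums only up
  -- to null sequences.
  toSubalgebra := Algebra.adjoin ℂ (Set.range S.cycleSeq)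
  star_mem' {x} hx := by
    change star x ∈ Algebra.adjoin ℂ (Set.range S.cycleSeq)
    induction hx using Algebra.adjoin_induction with
    | mem x hx =>
      obtain ⟨w, rfl⟩ := hx
      rw [star_cycleSeq]
      exact Algebra.subset_adjoin ⟨_, rfl⟩
    | algebraMap r =>
      rw [← algebraMap_star_comm]
      exact Subalgebra.algebraMap_mem _ _
    | add x y _ _ hx hy => rw [star_add]; exact add_mem hx hy
    | mul x y _ _ hx hy => rw [star_mul]; exact mul_mem hy hx

theorem cycleSeq_mem (w : List ι) : S.cycleSeq w ∈ S.cycleAlgebra :=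
  Algebra.subset_adjoin (Set.mem_range_self w)

theorem mem_l2Bounded_of_mem {x : ℕ → MonoidAlgebra ℂ finPerm} (hx : x ∈ S.cycleAlgebra) :
    x ∈ l2Bounded finPerm := by
  have hx' : x ∈ Subalgebra.toSubmodule (Algebra.adjoin ℂ (Set.range S.cycleSeq)) := hx
  rw [Algebra.adjoin_eq_span] at hx'
  refine Submodule.span_le.2 ?_ hx'
  intro y hy
  obtain ⟨L, hL, rfl⟩ := Submonoid.exists_list_of_mem_closure hy
  obtain ⟨L, rfl⟩ : ∃ L' : List (List ι), L'.map S.cycleSeq = L := by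
    clear hy
    induction L with
    | nil => exact ⟨[], rfl⟩
    | cons y L ih =>
      rw [List.forall_mem_cons] at hL
      obtain ⟨w, hw⟩ := hL.1
      obtain ⟨L', rfl⟩ := ih hL.2
      exact ⟨w :: L', by simp [hw]⟩
  exact S.prod_cycleSeq_mem_l2Bounded L

/-- The elements of the algebra of sequences which tend to `0` in `ℓ²`-norm. -/
noncomputable def nullIdeal : Submodule ℂ (ℕ → MonoidAlgebra ℂ finPerm) :=
  l2Null finPerm ⊓ Subalgebra.toSubmodule S.cycleAlgebra.toSubalgebra

variable {S}

theorem mul_mem_nullIdeal {b z : ℕ → MonoidAlgebra ℂ finPerm} (hb : b ∈ S.cycleAlgebra)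
    (hz : z ∈ S.nullIdeal) : b * z ∈ S.nullIdeal :=
  ⟨mul_mem_l2Null (S.mem_l2Bounded_of_mem (mul_mem (star_mem hb) (mul_mem hb hz.2))) hz.1,
    mul_mem (S := StarSubalgebra ℂ (ℕ → MonoidAlgebra ℂ finPerm)) hb hz.2⟩

theorem star_mem_nullIdeal {z : ℕ → MonoidAlgebra ℂ finPerm} (hz : z ∈ S.nullIdeal) :
    star z ∈ S.nullIdeal :=
  ⟨star_mem_l2Null hz.1,
    star_mem (S := StarSubalgebra ℂ (ℕ → MonoidAlgebra ℂ finPerm)) (s := S.cycleAlgebra) hz.2⟩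

theorem nullIdeal_mul_mem {b z : ℕ → MonoidAlgebra ℂ finPerm} (hb : b ∈ S.cycleAlgebra)
    (hz : z ∈ S.nullIdeal) : z * b ∈ S.nullIdeal := by
  have := star_mem_nullIdeal (mul_mem_nullIdeal (star_mem hb) (star_mem_nullIdeal hz))
  rwa [star_mul, star_star, star_star] at this

theorem singleton_mul_sub_mem_nullIdeal {i : ι} {w : List ι} (hw : w.head? ≠ some i) :
    S.cycleSeq [i] * S.cycleSeq w - S.cycleSeq (i :: w) ∈ S.nullIdeal :=
  ⟨S.singleton_mul_cycleSeq hw, sub_mem (S := StarSubalgebra ℂ (ℕ → MonoidAlgebra ℂ finPerm))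
    (mul_mem (S.cycleSeq_mem _) (S.cycleSeq_mem _)) (S.cycleSeq_mem _)⟩

theorem singleton_mul_cons_sub_mem_nullIdeal (i : ι) (w : List ι) :
    S.cycleSeq [i] * S.cycleSeq (i :: w) - S.cycleSeq (i :: i :: w)
      - (S.density i : ℂ) • S.cycleSeq w ∈ S.nullIdeal :=
  ⟨S.singleton_mul_cycleSeq_cons i w,
    sub_mem (S := StarSubalgebra ℂ (ℕ → MonoidAlgebra ℂ finPerm))
      (sub_mem (mul_mem (S.cycleSeq_mem _) (S.cycleSeq_mem _)) (S.cycleSeq_mem _))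
      (SMulMemClass.smul_mem _ (S.cycleSeq_mem _))⟩

variable (S) in
/-- The span, modulo null sequences, of the sums of cycles of the words in `U`. -/
noncomputable def wordSpan (U : Set (List ι)) : Submodule ℂ (ℕ → MonoidAlgebra ℂ finPerm) :=
  Submodule.span ℂ (S.cycleSeq '' U) ⊔ S.nullIdeal

theorem nullIdeal_le_wordSpan (U : Set (List ι)) : S.nullIdeal ≤ S.wordSpan U := le_sup_right

theorem cycleSeq_mem_wordSpan {U : Set (List ι)} {w : List ι} (hw : w ∈ U) :
    S.cycleSeq w ∈ S.wordSpan U :=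
  Submodule.mem_sup_left (Submodule.subset_span ⟨w, hw, rfl⟩)

theorem mem_wordSpan_of_sub_mem {U : Set (List ι)} {w : List ι} (hw : w ∈ U)
    {x : ℕ → MonoidAlgebra ℂ finPerm} (hx : x - S.cycleSeq w ∈ S.nullIdeal) :
    x ∈ S.wordSpan U := by
  rw [← sub_add_cancel x (S.cycleSeq w)]
  exact add_mem (nullIdeal_le_wordSpan U hx) (cycleSeq_mem_wordSpan hw)

theorem wordSpan_le {U : Set (List ι)} {P : Submodule ℂ (ℕ → MonoidAlgebra ℂ finPerm)}
    (h : ∀ w ∈ U, S.cycleSeq w ∈ P) (hP : S.nullIdeal ≤ P) : S.wordSpan U ≤ P := by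
  refine sup_le (Submodule.span_le.2 ?_) hP
  rintro _ ⟨w, hw, rfl⟩
  exact h w hw

theorem mem_cycleAlgebra_of_mem_wordSpan {U : Set (List ι)} {x : ℕ → MonoidAlgebra ℂ finPerm}
    (hx : x ∈ S.wordSpan U) : x ∈ S.cycleAlgebra :=
  wordSpan_le (P := Subalgebra.toSubmodule S.cycleAlgebra.toSubalgebra)
    (fun w _ => S.cycleSeq_mem w) inf_le_right hx

theorem mul_mem_wordSpan {U U' : Set (List ι)} {x y : ℕ → MonoidAlgebra ℂ finPerm}
    (hx : x ∈ S.cycleAlgebra) (h : ∀ w ∈ U, x * S.cycleSeq w ∈ S.wordSpan U')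
    (hy : y ∈ S.wordSpan U) : x * y ∈ S.wordSpan U' :=
  wordSpan_le (P := (S.wordSpan U').comap (LinearMap.mulLeft ℂ x)) h
    (fun _ hz => nullIdeal_le_wordSpan U' (mul_mem_nullIdeal hx hz)) hy

theorem wordSpan_mul_mem {U U' : Set (List ι)} {x y : ℕ → MonoidAlgebra ℂ finPerm}
    (hy : y ∈ S.cycleAlgebra) (h : ∀ w ∈ U, S.cycleSeq w * y ∈ S.wordSpan U')
    (hx : x ∈ S.wordSpan U) : x * y ∈ S.wordSpan U' :=
  wordSpan_le (P := (S.wordSpan U').comap (LinearMap.mulRight ℂ y)) h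
    (fun _ hz => nullIdeal_le_wordSpan U' (nullIdeal_mul_mem hy hz)) hx

theorem singleton_mul_mem_wordSpan {K : Set ι} {i : ι} (hi : i ∈ K)
    {y : ℕ → MonoidAlgebra ℂ finPerm} (hy : y ∈ S.wordSpan {w | ∀ j ∈ w, j ∈ K}) :
    S.cycleSeq [i] * y ∈ S.wordSpan {w | ∀ j ∈ w, j ∈ K} := by
  refine mul_mem_wordSpan (S.cycleSeq_mem _) (fun w hw => ?_) hy
  have hiw : i :: w ∈ {w : List ι | ∀ j ∈ w, j ∈ K} := List.forall_mem_cons.2 ⟨hi, hw⟩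
  by_cases h : w.head? = some i
  · obtain ⟨w, rfl⟩ := List.head?_eq_some_iff.1 h
    have := nullIdeal_le_wordSpan {w | ∀ j ∈ w, j ∈ K}
      (singleton_mul_cons_sub_mem_nullIdeal (S := S) i w)
    rwa [Submodule.sub_mem_iff_left, Submodule.sub_mem_iff_left] at this
    · exact cycleSeq_mem_wordSpan hiw
    · exact Submodule.smul_mem _ _ (cycleSeq_mem_wordSpan (List.forall_mem_cons.1 hw).2)
  · exact mem_wordSpan_of_sub_mem hiw (singleton_mul_sub_mem_nullIdeal h)

/-- The multiplication rule, read backwards, expresses the word `i :: k :: w` through `[i]` times `k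
:: w` and, if `i = k`, the shorter word `w`; hence the two-step recursion. -/
theorem cycleSeq_mul_mem_wordSpan {K : Set ι} {y : ℕ → MonoidAlgebra ℂ finPerm}
    (hy : y ∈ S.wordSpan {w | ∀ j ∈ w, j ∈ K}) :
    ∀ w : List ι, (∀ j ∈ w, j ∈ K) → S.cycleSeq w * y ∈ S.wordSpan {w | ∀ j ∈ w, j ∈ K}
  | [], _ => by rwa [cycleSeq_nil, one_mul]
  | [i], h => singleton_mul_mem_wordSpan (h i (by simp)) hy
  | i :: k :: w, h => by
    rw [List.forall_mem_cons] at h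
    have hyB := mem_cycleAlgebra_of_mem_wordSpan hy
    have h1 := singleton_mul_mem_wordSpan h.1 (cycleSeq_mul_mem_wordSpan hy (k :: w) h.2)
    by_cases hik : i = k
    · subst hik
      have h2 := nullIdeal_le_wordSpan {w | ∀ j ∈ w, j ∈ K}
        (nullIdeal_mul_mem hyB (singleton_mul_cons_sub_mem_nullIdeal (S := S) i w))
      have h3 := Submodule.smul_mem _ (S.density i : ℂ)
        (cycleSeq_mul_mem_wordSpan hy w (List.forall_mem_cons.1 h.2).2)
      rwa [sub_mul, sub_mul, mul_assoc, smul_mul_assoc, Submodule.sub_mem_iff_left _ h3,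
        Submodule.sub_mem_iff_right _ h1] at h2
    · have h2 := nullIdeal_le_wordSpan {w | ∀ j ∈ w, j ∈ K} (nullIdeal_mul_mem hyB
        (singleton_mul_sub_mem_nullIdeal (S := S) (i := i) (w := k :: w)
          (by simpa using Ne.symm hik)))
      rwa [sub_mul, mul_assoc, Submodule.sub_mem_iff_right _ h1] at h2

/-- The algebra generated by words in the letters of `K` is spanned, modulo null sequences, by
words in these letters. -/
theorem mem_wordSpan_of_mem_adjoin {K : Set ι} {x : ℕ → MonoidAlgebra ℂ finPerm}
    (hx : x ∈ Algebra.adjoin ℂ (S.cycleSeq '' {w | ∀ j ∈ w, j ∈ K})) :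
    x ∈ S.wordSpan {w | ∀ j ∈ w, j ∈ K} := by
  -- Stability under left multiplication passes to sums and products of generators; applying it to
  -- the empty word, which is `1`, gives the claim.
  suffices h : ∀ y ∈ S.wordSpan {w | ∀ j ∈ w, j ∈ K}, x * y ∈ S.wordSpan {w | ∀ j ∈ w, j ∈ K} by
    have := h _ (cycleSeq_mem_wordSpan (w := []) (by simp))
    rwa [cycleSeq_nil, mul_one] at this
  induction hx using Algebra.adjoin_induction with
  | mem x hx =>
    obtain ⟨w, hw, rfl⟩ := hx
    exact fun y hy => cycleSeq_mul_mem_wordSpan hy w hw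
  | algebraMap r =>
    intro y hy
    rw [← Algebra.smul_def]
    exact Submodule.smul_mem _ _ hy
  | add x x' _ _ hx hx' =>
    intro y hy
    rw [add_mul]
    exact add_mem (hx y hy) (hx' y hy)
  | mul x x' _ _ hx hx' =>
    intro y hy
    rw [mul_assoc]
    exact hx _ (hx' y hy)

theorem mem_wordSpan_univ {x : ℕ → MonoidAlgebra ℂ finPerm} (hx : x ∈ S.cycleAlgebra) :
    x ∈ S.wordSpan Set.univ := by
  have h : Set.univ = {w : List ι | ∀ j ∈ w, j ∈ Set.univ} := by ext; simp
  rw [h]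
  refine mem_wordSpan_of_mem_adjoin ?_
  rw [← h, Set.image_univ]
  exact hx

/-! ### Alternating products and freeness -/

/-- As `u` does not start with `i`, no cancellation crosses the boundary: `w ↦ w * u` and `w ↦ w ++
u` satisfy the same three-term recursion with the same initial values, modulo null sequences. -/
theorem cycleSeq_mul_sub_mem_nullIdeal {i : ι} {u : List ι} (hu : u.head? ≠ some i) :
    ∀ w : List ι, (∀ j ∈ w, j = i) →
      S.cycleSeq w * S.cycleSeq u - S.cycleSeq (w ++ u) ∈ S.nullIdeal
  | [], _ => by simp [cycleSeq_nil]
  | [j], h => by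
    obtain rfl : j = i := h j (by simp)
    exact singleton_mul_sub_mem_nullIdeal hu
  | j :: k :: w, h => by
    rw [List.forall_mem_cons] at h
    obtain rfl := h.1
    obtain rfl : k = j := (List.forall_mem_cons.1 h.2).1
    have h1 := mul_mem_nullIdeal (S.cycleSeq_mem [k])
      (cycleSeq_mul_sub_mem_nullIdeal hu (k :: w) h.2)
    have h2 := Submodule.smul_mem _ (S.density k : ℂ)
      (cycleSeq_mul_sub_mem_nullIdeal hu w (List.forall_mem_cons.1 h.2).2)
    have h3 := nullIdeal_mul_mem (S.cycleSeq_mem u)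
      (singleton_mul_cons_sub_mem_nullIdeal (S := S) k w)
    have h4 := singleton_mul_cons_sub_mem_nullIdeal (S := S) k (w ++ u)
    convert add_mem (sub_mem (sub_mem h1 h2) h3) h4 using 1
    simp only [List.cons_append, mul_sub, sub_mul, smul_sub, smul_mul_assoc, mul_assoc]
    abel

/-- Induction step for alternating products: the first letter records which algebra the leftmost
factor comes from. The `Option` covers the empty product, whose word has no head. -/
theorem mul_mem_wordSpan_head {i : ι} {o : Option ι} (ho : o ≠ some i)
    {x y : ℕ → MonoidAlgebra ℂ finPerm} (hx : x ∈ S.wordSpan ({w | ∀ j ∈ w, j = i} \ {[]}))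
    (hy : y ∈ S.wordSpan {w | w.head? = o}) : x * y ∈ S.wordSpan {w | w.head? = some i} := by
  refine wordSpan_mul_mem (mem_cycleAlgebra_of_mem_wordSpan hy) (fun w hw => ?_) hx
  refine mul_mem_wordSpan (S.cycleSeq_mem _) (fun u hu => ?_) hy
  refine mem_wordSpan_of_sub_mem (w := w ++ u) ?_
    (cycleSeq_mul_sub_mem_nullIdeal (fun e => ho (hu.symm.trans e)) w hw.1)
  cases w with
  | nil => exact absurd rfl hw.2
  | cons j w => simpa using hw.1 j (by simp)

theorem prod_mem_wordSpan_head (l : List (ι × (ℕ → MonoidAlgebra ℂ finPerm)))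
    (hl : (l.map Prod.fst).IsChain (· ≠ ·))
    (h : ∀ q ∈ l, q.2 ∈ S.wordSpan ({w | ∀ j ∈ w, j = q.1} \ {[]})) :
    (l.map Prod.snd).prod ∈ S.wordSpan {w | w.head? = (l.map Prod.fst).head?} := by
  induction l with
  | nil =>
    rw [List.map_nil, List.map_nil, List.prod_nil, ← S.cycleSeq_nil]
    exact cycleSeq_mem_wordSpan (by simp)
  | cons q l ih =>
    rw [List.forall_mem_cons] at h
    rw [List.map_cons, List.isChain_cons] at hl
    rw [List.map_cons, List.map_cons, List.prod_cons]
    refine mul_mem_wordSpan_head (fun e => ?_) h.1 (ih hl.2 h.2)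
    exact hl.1 _ e rfl

theorem tendsto_coeff_one_of_mem_wordSpan {U : Set (List ι)} (hU : [] ∉ U)
    {x : ℕ → MonoidAlgebra ℂ finPerm} (hx : x ∈ S.wordSpan U) :
    Tendsto (fun n => (x n).coeff 1) atTop (𝓝 0) := by
  let P : Submodule ℂ (ℕ → MonoidAlgebra ℂ finPerm) :=
    { carrier := {x | Tendsto (fun n => (x n).coeff 1) atTop (𝓝 0)}
      zero_mem' := by simp
      add_mem' := fun {x y} hx hy => by simpa using Tendsto.add hx hy
      smul_mem' := fun c x hx => by simpa using Tendsto.const_mul c hx }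
  refine wordSpan_le (P := P) (fun w hw => ?_) (fun z hz => tendsto_coeff_one_of_mem_l2Null hz.1) hx
  refine tendsto_const_nhds.congr fun n => (coeff_one_wordSum (S.subset n) _ ?_).symm
  rintro rfl
  exact hU hw

theorem exists_sub_smul_one_mem_wordSpan {U : Set (List ι)} {x : ℕ → MonoidAlgebra ℂ finPerm}
    (hx : x ∈ S.wordSpan U) : ∃ c : ℂ, x - c • 1 ∈ S.wordSpan (U \ {[]}) := by
  have h : x ∈ Submodule.span ℂ {1} ⊔ S.wordSpan (U \ {[]}) := by
    refine wordSpan_le (fun w hw => ?_)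
      ((nullIdeal_le_wordSpan _).trans le_sup_right) hx
    by_cases hw0 : w = []
    · rw [hw0, cycleSeq_nil]
      exact Submodule.mem_sup_left (Submodule.mem_span_singleton_self 1)
    · exact Submodule.mem_sup_right (cycleSeq_mem_wordSpan ⟨hw, hw0⟩)
  obtain ⟨y, hy, z, hz, rfl⟩ := Submodule.mem_sup.1 h
  obtain ⟨c, rfl⟩ := Submodule.mem_span_singleton.1 hy
  exact ⟨c, by rwa [add_sub_cancel_left]⟩

theorem tendsto_coeff_one_of_sub_mem {U : Set (List ι)} (hU : [] ∉ U) {c : ℂ}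
    {x : ℕ → MonoidAlgebra ℂ finPerm} (hx : x - c • 1 ∈ S.wordSpan U) :
    Tendsto (fun n => (x n).coeff 1) atTop (𝓝 c) := by
  have h := (tendsto_coeff_one_of_mem_wordSpan hU hx).add_const c
  simpa [MonoidAlgebra.one_def] using h

variable (S) in
/-- The limit of the traces, as a state on the algebra of sequences. -/
noncomputable def limitState : NCState S.cycleAlgebra :=
  -- Modulo null sequences `x` is a scalar plus nonempty words, so its traces converge and
  -- `limUnder` is the actual limit; all state axioms then pass to the limit.
  have lim : ∀ x : S.cycleAlgebra, Tendsto (fun n => (x.1 n).coeff 1) atTop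
      (𝓝 (limUnder atTop fun n => (x.1 n).coeff 1)) := fun x => by
    obtain ⟨c, hc⟩ := exists_sub_smul_one_mem_wordSpan (mem_wordSpan_univ x.2)
    exact tendsto_nhds_limUnder ⟨c, tendsto_coeff_one_of_sub_mem (by simp) hc⟩
  { toFun := fun x => limUnder atTop fun n => (x.1 n).coeff 1
    map_add' := fun x y => tendsto_nhds_unique (lim (x + y)) (by simpa using (lim x).add (lim y))
    map_smul' := fun c x =>
      tendsto_nhds_unique (lim (c • x)) (by simpa using (lim x).const_mul c)
    map_one' := tendsto_nhds_unique (lim 1)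
      (tendsto_const_nhds.congr fun n => ((groupTrace finPerm).map_one').symm)
    map_star' := fun x => tendsto_nhds_unique (lim (star x))
      ((lim x).star.congr fun n => ((groupTrace finPerm).map_star' (x.1 n)).symm)
    nonneg' := fun x => ge_of_tendsto' (lim (x * star x))
      fun n => (groupTrace finPerm).nonneg' (x.1 n) }

theorem tendsto_limitState (x : S.cycleAlgebra) :
    Tendsto (fun n => (x.1 n).coeff 1) atTop (𝓝 (S.limitState.toLinearMap x)) := by
  obtain ⟨c, hc⟩ := exists_sub_smul_one_mem_wordSpan (mem_wordSpan_univ x.2)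
  exact tendsto_nhds_limUnder ⟨c, tendsto_coeff_one_of_sub_mem (by simp) hc⟩

theorem coe_prod_map_snd (l : List (ι × S.cycleAlgebra)) :
    ((l.map Prod.snd).prod : S.cycleAlgebra).1
      = ((l.map fun q => (q.1, q.2.1)).map Prod.snd).prod := by
  induction l with
  | nil => rfl
  | cons q l ih => simp only [List.map_cons, List.prod_cons, ← ih]; rfl

theorem coe_mem_wordSpan_of_mem_adjoin {i : ι} {w : List ι} (hw : ∀ j ∈ w, j = i)
    {x : S.cycleAlgebra}
    (hx : x ∈ Algebra.adjoin ℂ {(⟨S.cycleSeq w, S.cycleSeq_mem w⟩ : S.cycleAlgebra)}) :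
    x.1 ∈ S.wordSpan {w | ∀ j ∈ w, j = i} := by
  refine mem_wordSpan_of_mem_adjoin (K := {i}) ?_
  have h : S.cycleAlgebra.subtype x ∈ (Algebra.adjoin ℂ
      {(⟨S.cycleSeq w, S.cycleSeq_mem w⟩ : S.cycleAlgebra)}).map
        S.cycleAlgebra.subtype.toAlgHom :=
    Subalgebra.mem_map.2 ⟨_, hx, rfl⟩
  rw [AlgHom.map_adjoin, Set.image_singleton] at h
  refine Algebra.adjoin_mono ?_ h
  rw [Set.singleton_subset_iff]
  exact ⟨w, hw, rfl⟩

/-- The coefficient of the empty word is the limit of the traces. -/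
theorem mem_wordSpan_of_limitState_eq_zero {U : Set (List ι)} {x : S.cycleAlgebra}
    (hx : x.1 ∈ S.wordSpan U) (h0 : S.limitState.toLinearMap x = 0) :
    x.1 ∈ S.wordSpan (U \ {[]}) := by
  obtain ⟨c, hc⟩ := exists_sub_smul_one_mem_wordSpan hx
  have hc0 : c = 0 := by
    rw [← h0]
    exact tendsto_nhds_unique (tendsto_coeff_one_of_sub_mem (by simp) hc) (tendsto_limitState _)
  rwa [hc0, zero_smul, sub_zero] at hc

theorem limitState_prod_eq_zero {l : List (ι × S.cycleAlgebra)} (hl : l ≠ [])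
    (hchain : (l.map Prod.fst).IsChain (· ≠ ·))
    (h : ∀ q ∈ l, q.2.1 ∈ S.wordSpan ({w | ∀ j ∈ w, j = q.1} \ {[]})) :
    S.limitState.toLinearMap (l.map Prod.snd).prod = 0 := by
  have hfst : (l.map fun q => (q.1, q.2.1)).map Prod.fst = l.map Prod.fst := by
    rw [List.map_map]; rfl
  have hprod := prod_mem_wordSpan_head (S := S) (l.map fun q => (q.1, q.2.1))
    (by rw [hfst]; exact hchain) (fun q hq => by
      obtain ⟨q', hq', rfl⟩ := List.mem_map.1 hq
      exact h q' hq')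
  rw [hfst, ← coe_prod_map_snd] at hprod
  refine tendsto_nhds_unique (tendsto_limitState _) (tendsto_coeff_one_of_mem_wordSpan ?_ hprod)
  -- The empty word has no head, whereas the words at hand start with the first index of `l`.
  simpa [eq_comm] using hl

theorem isFreeFamily_cycleSeq (r : ι → ℕ) :
    IsFreeFamily S.limitState.toLinearMap fun i =>
      (⟨S.cycleSeq (List.replicate (r i) i), S.cycleSeq_mem _⟩ : S.cycleAlgebra) :=
  fun _ hl hchain h => limitState_prod_eq_zero hl hchain fun q hq =>
    mem_wordSpan_of_limitState_eq_zero (coe_mem_wordSpan_of_mem_adjoin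
      (fun _ => List.eq_of_mem_replicate) (h q hq).1) (h q hq).2

/-- Self-adjointness holds because the word `i ⋯ i` is a palindrome. Convergence of distributions is
built into `limitState`, as evaluation at `n` is an algebra homomorphism. -/
theorem asymptoticallyFree_cycleSeq {ι : Type} (S : IndexSystem ι) (r : ι → ℕ) :
    AsymptoticallyFree (groupTrace finPerm) fun n i => S.cycleSeq (List.replicate (r i) i) n := by
  have hstar : ∀ i, star (S.cycleSeq (List.replicate (r i) i))
      = S.cycleSeq (List.replicate (r i) i) := fun i => by
    rw [star_cycleSeq, List.reverse_replicate]
  refine ⟨fun n i => congrFun (hstar i) n, S.cycleAlgebra, inferInstance, inferInstance,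
    inferInstance, inferInstance, S.limitState,
    fun i => ⟨S.cycleSeq (List.replicate (r i) i), S.cycleSeq_mem _⟩,
    fun i => Subtype.ext (hstar i), isFreeFamily_cycleSeq r, fun P => ?_⟩
  refine (tendsto_limitState _).congr fun n => ?_
  have h : ((Pi.evalAlgHom ℂ (fun _ : ℕ => MonoidAlgebra ℂ finPerm) n).comp
      S.cycleAlgebra.subtype.toAlgHom).comp (FreeAlgebra.lift ℂ fun i =>
        (⟨S.cycleSeq (List.replicate (r i) i), S.cycleSeq_mem _⟩ : S.cycleAlgebra))
      = FreeAlgebra.lift ℂ fun i => S.cycleSeq (List.replicate (r i) i) n := by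
    ext i
    simp
  exact congrArg (fun x : MonoidAlgebra ℂ finPerm => x.coeff 1) (DFunLike.congr_fun h P)

end IndexSystem

/-! ### Application to the intervals `(n t_{i-1}, n t_i]` -/

theorem mem_nodupLists_replicate {ι : Type*} {I : ι → Finset ℕ} {r : ℕ} {i : ι} {l : List ℕ} :
    l ∈ nodupLists I (List.replicate r i) ↔ l.Nodup ∧ l.length = r ∧ ∀ x ∈ l, x ∈ I i := by
  rw [mem_nodupLists]
  refine and_congr_right fun hn => ?_
  induction r generalizing l with
  | zero => simp +contextual [List.length_eq_zero_iff]
  | succ r ih =>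
    cases l with
    | nil => simp [List.replicate_succ]
    | cons a l => simp [List.replicate_succ, ih hn.of_cons]; tauto

theorem mem_Ioc_floor_iff {u v : ℝ} (hu : 0 ≤ u) (k : ℕ) :
    k ∈ Finset.Ioc ⌊u⌋₊ ⌊v⌋₊ ↔ u < (k : ℝ) ∧ (k : ℝ) ≤ v := by
  rw [Finset.mem_Ioc, Nat.floor_lt hu]
  refine and_congr_right fun h => ?_
  -- The sign of `v` is not assumed; `k ≠ 0`, which follows from `0 ≤ u < k`, makes the floor
  -- criterion valid.
  exact Nat.le_floor_iff' (by rintro rfl; simp at h; linarith)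

theorem cycleSum_eq_wordSum {ι : Type*} (I : ι → Finset ℕ) (r : ℕ) {u v : ℝ} (hu : 0 ≤ u) (n : ℕ)
    (i : ι) (hI : I i = Finset.Ioc ⌊n * u⌋₊ ⌊n * v⌋₊) :
    cycleSum r u v n = wordSum I (√n)⁻¹ (List.replicate r i) := by
  have hmem : ∀ k : ℕ, k ∈ I i ↔ (n * u : ℝ) < k ∧ (k : ℝ) ≤ n * v := fun k => by
    rw [hI, mem_Ioc_floor_iff (by positivity)]
  rw [cycleSum, wordSum, List.length_replicate]
  refine congrArg₂ (· • ·) (congrArg _ ?_) ?_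
  · rw [Real.sqrt_eq_rpow, ← Real.rpow_neg (Nat.cast_nonneg n), ← Real.rpow_natCast,
      ← Real.rpow_mul (Nat.cast_nonneg n)]
    congr 1
    ring
  -- The list is reversed because `(0 a₁ ⋯ a_r) = (0 a_r) ⋯ (0 a₁)`.
  · refine Finset.sum_bij (fun a _ => (List.ofFn a).reverse) ?_ ?_ ?_ ?_
    · intro a ha
      rw [mem_distinctTuples] at ha
      rw [mem_nodupLists_replicate, List.nodup_reverse, List.nodup_ofFn]
      refine ⟨ha.2, by simp, fun x hx => ?_⟩
      rw [List.mem_reverse, List.mem_ofFn] at hx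
      obtain ⟨j, rfl⟩ := hx
      exact (hmem _).2 (ha.1 j)
    · intro a _ a' _ h
      exact List.ofFn_injective (List.reverse_injective h)
    · intro l hl
      rw [mem_nodupLists_replicate] at hl
      obtain ⟨hn, rfl, hl⟩ := hl
      refine ⟨fun j => l.reverse[(j : ℕ)]'(by simp), ?_, ?_⟩
      · rw [mem_distinctTuples]
        refine ⟨fun j => (hmem _).1 (hl _ (List.mem_reverse.1 (List.getElem_mem _))), ?_⟩
        intro j j' h
        exact Fin.ext ((List.nodup_reverse.2 hn).getElem_inj_iff.1 h)
      · rw [List.reverse_eq_iff]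
        apply List.ext_getElem <;> simp
    · intro a ha
      rw [mem_distinctTuples] at ha
      rw [zeroCycle_eq_swapProd a ha.2]
      intro j h0
      have := (ha.1 j).1
      rw [h0, Nat.cast_zero] at this
      exact absurd this (not_lt.2 (by positivity))

theorem tendsto_card_Ioc_floor_div {u v : ℝ} (hu : 0 ≤ u) (huv : u ≤ v) :
    Tendsto (fun n : ℕ => ((Finset.Ioc ⌊n * u⌋₊ ⌊n * v⌋₊).card : ℝ) / n) atTop (𝓝 (v - u)) := by
  have h := ((tendsto_nat_floor_mul_div_atTop (hu.trans huv)).sub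
    (tendsto_nat_floor_mul_div_atTop hu)).comp (tendsto_natCast_atTop_atTop (R := ℝ))
  refine h.congr fun n => ?_
  have : ⌊(n : ℝ) * u⌋₊ ≤ ⌊(n : ℝ) * v⌋₊ := Nat.floor_mono (by gcongr)
  rw [Nat.card_Ioc, Nat.cast_sub this, sub_div, Function.comp_apply, mul_comm v, mul_comm u]

/-- The index system of the integers of the intervals `(n t_{i-1}, n t_i]`. -/
noncomputable def intervalSystem (p : ℕ) (t : Fin (p + 1) → ℝ) (ht0 : 0 ≤ t 0)
    (ht : StrictMono t) : IndexSystem (Fin p) where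
  idx i n := Finset.Ioc ⌊n * t i.castSucc⌋₊ ⌊n * t i.succ⌋₊
  top n := ⌊n * t (Fin.last p)⌋₊
  growth := t (Fin.last p)
  density i := t i.succ - t i.castSucc
  disjoint n i j hij := by
    have key : ∀ i j : Fin p, i < j → Disjoint
        (Finset.Ioc ⌊n * t i.castSucc⌋₊ ⌊n * t i.succ⌋₊)
        (Finset.Ioc ⌊n * t j.castSucc⌋₊ ⌊n * t j.succ⌋₊) := fun i j h => by
      have h1 : t i.succ ≤ t j.castSucc := ht.monotone (Fin.succ_le_castSucc_iff.2 h)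
      have h2 : ⌊n * t i.succ⌋₊ ≤ ⌊n * t j.castSucc⌋₊ := Nat.floor_mono (by gcongr)
      refine Finset.disjoint_left.2 fun k hk hk' => ?_
      rw [Finset.mem_Ioc] at hk hk'
      omega
    rcases lt_or_gt_of_ne hij with h | h
    · exact key i j h
    · exact (key j i h).symm
  subset n i := fun k hk => by
    have h1 : t i.succ ≤ t (Fin.last p) := ht.monotone (Fin.le_last _)
    have h2 : ⌊n * t i.succ⌋₊ ≤ ⌊n * t (Fin.last p)⌋₊ := Nat.floor_mono (by gcongr)
    rw [Finset.mem_Ioc] at hk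
    rw [Finset.mem_Icc]
    omega
  top_le n := by
    have h1 : 0 ≤ t (Fin.last p) := ht0.trans (ht.monotone (Fin.zero_le _))
    rw [mul_comm]
    exact Nat.floor_le (by positivity)
  tendsto i := tendsto_card_Ioc_floor_div (ht0.trans (ht.monotone (Fin.zero_le _)))
    (ht.monotone i.castSucc_lt_succ.le)

theorem mainTheorem3 (p : ℕ) (hp : 1 ≤ p) (r : Fin p → ℕ) (t : Fin (p + 1) → ℝ)
    (ht0 : 0 ≤ t 0) (ht : StrictMono t) :
    AsymptoticallyFree (groupTrace finPerm)
      (fun (n : ℕ) (i : Fin p) => cycleSum (r i) (t i.castSucc) (t i.succ) n) := by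
  have h : (fun (n : ℕ) (i : Fin p) => cycleSum (r i) (t i.castSucc) (t i.succ) n)
      = fun n i => (intervalSystem p t ht0 ht).cycleSeq (List.replicate (r i) i) n := by
    funext n i
    exact cycleSum_eq_wordSum (fun i => (intervalSystem p t ht0 ht).idx i n) _
      (ht0.trans (ht.monotone (Fin.zero_le _))) n i rfl
  rw [h]
  exact (intervalSystem p t ht0 ht).asymptoticallyFree_cycleSeq r
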